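/- **Setting.** Let $n\ge 1$, let $X\in\mathbb R^{n\times n}$ be symmetric with zero diagonal, let $M_1\ge M_2\ge 0$, let $\sigma(x)=1/(1+e^{-x})$ and $J=I_n-\frac1n 1_n1_n^\top$. Let $\|\cdot\|_F$, $\|\cdot\|_{op}$, $\|\cdot\|_*$ be the Frobenius, operator and nuclear norms, $\langle U,V\rangle=\mathrm{Tr}(U^\top V)$, and $r_{\rm stable}(X)=\|X\|_F^2/\|X\|_{op}^2$ for $X\neq0$. A matrix $\Theta\in\mathbb R^{n\times n}$ satisfies the box constraint if $-M_1\le\Theta_{ij}\le -M_2$ for all $i\ne j$ and $|\Theta_{ii}|\le M_1$ for all $i$. The class $\mathcal F_g=\mathcal F_g(n,M_1,M_2,X)$ consists of all $\Theta_\star=\alpha_\star1_n^\top+1_n\alpha_\star^\top+\beta_\star X+G_\star$ satisfying the box constraint, where $G_\star$ is symmetric positive semidefinite with $JG_\star=G_\star$, and $\max_i (G_\star)_{ii}$, $\|\alpha_\star\|_\infty$, $|\beta_\star|\max_{i<j}|X_{ij}|\le M_1/3$ if $X\ne0$, respectively $\max_i (G_\star)_{ii}$, $\|\alpha_\star\|_\infty\le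 M_1/2$ if $X=0$. Put $P=\sigma(\Theta_\star)$ entrywise, diagonal included. For an integer $k\ge1$ let $\bar G_k=G_\star-B$, where $B$ is a best approximation of $G_\star$ in Frobenius norm among matrices of rank at most $k$. Given the adjacency matrix $A$ of a simple undirected graph on $n$ nodes and $\lambda_n$, let $(\hat\alpha,\hat\beta,\hat G)$ be any solution of the convex program $$\min_{\alpha,\beta,G}\; -\sum_{i,j=1}^n\{A_{ij}\Theta_{ij}+\log(1-\sigma(\Theta_{ij}))\}+\lambda_n\mathrm{Tr}(G)$$ subject to $\Theta=\alpha1_n^\top+1_n\alpha^\top+\beta X+G$, $GJ=G$, $G$ symmetric positive semidefinite, and $\Theta$ satisfying the box constraint; let $\hat\Theta=\hat\alpha1_n^\top+1_n\hat\alpha^\top+\hat\beta X+\hat G$. **Theorem.** There is an absolute constant $M_0>0$ such that the following holds, where the assumption on $(X,k)$ is that $r_{\rm stable}(X)\ge M_0k$ if $X\neq 0$ (no assumption if $X=0$). (1) There is an absolute constant $C>0$ such that for all $n,k\ge1$, $M_1\ge M_2\ge0$, $X$ satisfying the assumption, all $\Theta_\star\in\mathcal F_g$ (with components $\alpha_\star,\beta_\star,G_\star$),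 all adjacency matrices $A$ and all $\lambda_n\ge\max\{2\|A-P\|_{op},\,|\langle A-P,X/\|X\|_F\rangle|/\sqrt k,\,1\}$ (the middle term being $0$ if $X=0$), $$\|\hat\Theta-\Theta_\star\|_F^2\le C\big(e^{2M_1}\lambda_n^2k+e^{M_1}\lambda_n\|\bar G_k\|_*\big).$$ (2) For every sufficiently large absolute constant $C_0$ there are constants $c,C>0$ depending only on $C_0$ such that for all $n,k\ge 1$, $M_1\ge M_2\ge0$, $X$ satisfying the assumption and all $\Theta_\star\in\mathcal F_g$ (with components $\alpha_\star,\beta_\star,G_\star$): if $A_{ij}=A_{ji}$, $i<j$, are independent Bernoulli$(P_{ij})$ variables, $A_{ii}=0$, and $\lambda_n=C_0\sqrt{\max\{ne^{-M_2},\log n\}}$, then with probability at least $1-n^{-c}$ every solution of the convex program satisfies, for $X\ne0$, $$\|\hat\Theta-\Theta_\star\|_F^2\le C\big(\psi_n^2+e^{M_1-M_2/2}\sqrt n\,\|\bar G_k\|_*\big),\qquad \psi_n^2=e^{2M_1}nk\,\max\{e^{-M_2},\tfrac{\log n}{n}\},$$ and, for $X=0$, $$\|\hat\Theta-\Theta_\star\|_F^2\le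 C\big(\psi_n^2+e^{M_1}\sqrt{\max\{ne^{-M_2},\log n\}}\,\|\bar G_k\|_*\big),$$ which is the same bound whenever $ne^{-M_2}\ge\log n$. -/

import Mathlib

open MeasureTheory ProbabilityTheory

noncomputable section

namespace LatentSpace

/-! ### Matrix norms and related quantities -/

/-- Frobenius norm. -/
def frobNorm {n : ℕ} (M : Matrix (Fin n) (Fin n) ℝ) : ℝ :=
  √(∑ i, ∑ j, M i j ^ 2)

/-- Operator (spectral) norm: the norm of `M` acting on Euclidean space. -/
def opNorm {n : ℕ} (M : Matrix (Fin n) (Fin n) ℝ) : ℝ :=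
  ‖Matrix.toEuclideanCLM (𝕜 := ℝ) M‖

/-- Nuclear norm: the sum of the `n` singular values. -/
def nuclearNorm {n : ℕ} (M : Matrix (Fin n) (Fin n) ℝ) : ℝ :=
  ∑ i ∈ Finset.range n, (Matrix.toEuclideanLin M).singularValues i

/-- Trace inner product `Tr(Mᵀ N)`. -/
def traceInner {n : ℕ} (M N : Matrix (Fin n) (Fin n) ℝ) : ℝ :=
  (M.transpose * N).trace

/-- Stable rank `‖X‖_F² / ‖X‖_op²` (only meaningful for `X ≠ 0`). -/
def stableRank {n : ℕ} (X : Matrix (Fin n) (Fin n) ℝ) : ℝ :=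
  frobNorm X ^ 2 / opNorm X ^ 2

/-- `B` is a best approximation of `G`, in Frobenius norm, among matrices of rank at most `k`. -/
def IsBestRankApprox {n : ℕ} (k : ℕ) (G B : Matrix (Fin n) (Fin n) ℝ) : Prop :=
  B.rank ≤ k ∧
    ∀ B' : Matrix (Fin n) (Fin n) ℝ, B'.rank ≤ k → frobNorm (G - B) ≤ frobNorm (G - B')

/-- The centering matrix `J = I - (1/n) 1 1ᵀ`. -/
def centering (n : ℕ) : Matrix (Fin n) (Fin n) ℝ :=
  1 - (1 / (n : ℝ)) • Matrix.of fun _ _ => (1 : ℝ)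

/-! ### The latent space model -/

/-- `X` is a symmetric pairwise covariate matrix with zero diagonal. -/
def IsCovariate {n : ℕ} (X : Matrix (Fin n) (Fin n) ℝ) : Prop :=
  X.IsSymm ∧ ∀ i, X i i = 0

/-- The logit matrix `Θ = α 1ᵀ + 1 αᵀ + β X + G`. -/
def logitMatrix {n : ℕ} (X : Matrix (Fin n) (Fin n) ℝ)
    (α : Fin n → ℝ) (β : ℝ) (G : Matrix (Fin n) (Fin n) ℝ) : Matrix (Fin n) (Fin n) ℝ :=
  Matrix.of fun i j => α i + α j + β * X i j + G i j

/-- Entrywise sigmoid `P = σ(Θ)`, diagonal included. -/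
def probMatrix {n : ℕ} (Θ : Matrix (Fin n) (Fin n) ℝ) : Matrix (Fin n) (Fin n) ℝ :=
  Matrix.of fun i j => Real.sigmoid (Θ i j)

/-- The box constraint on logits: `-M₁ ≤ Θ_ij ≤ -M₂` off the diagonal, `|Θ_ii| ≤ M₁` on it. -/
def LogitBox {n : ℕ} (M₁ M₂ : ℝ) (Θ : Matrix (Fin n) (Fin n) ℝ) : Prop :=
  (∀ i j, i ≠ j → -M₁ ≤ Θ i j ∧ Θ i j ≤ -M₂) ∧ ∀ i, |Θ i i| ≤ M₁

/-- The parameters `(α, β, G)` of the general class: `G` is positive semidefinite and centered,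
the components are bounded (by `M₁/3` each when there is a covariate; by `M₁/2`, with no
restriction on the then irrelevant `β`, when `X = 0`), and the logit matrix satisfies the box
constraint. -/
structure InGeneralClass {n : ℕ} (M₁ M₂ : ℝ) (X : Matrix (Fin n) (Fin n) ℝ)
    (α : Fin n → ℝ) (β : ℝ) (G : Matrix (Fin n) (Fin n) ℝ) : Prop where
  psd : G.PosSemidef
  centered : centering n * G = G
  bounded_of_ne_zero : X ≠ 0 →
    (∀ i, G i i ≤ M₁ / 3) ∧ (∀ i, |α i| ≤ M₁ / 3) ∧
      ∀ i j, i < j → |β| * |X i j| ≤ M₁ / 3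
  bounded_of_eq_zero : X = 0 → (∀ i, G i i ≤ M₁ / 2) ∧ ∀ i, |α i| ≤ M₁ / 2
  box : LogitBox M₁ M₂ (logitMatrix X α β G)

/-- `A` is a random undirected simple graph (given by its adjacency matrix) whose edges are
independent, the edge `{i, j}` being present with probability `P i j`. -/
structure IsRandomNetwork {n : ℕ} {Ω : Type*} [MeasurableSpace Ω] (μ : Measure Ω)
    (P : Matrix (Fin n) (Fin n) ℝ) (A : Ω → Matrix (Fin n) (Fin n) ℝ) : Prop where
  measurable : ∀ i j, Measurable fun ω => A ω i j
  adj : ∀ ω, (A ω).IsAdjMatrix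
  prob : ∀ i j, i < j → μ.real {ω | A ω i j = 1} = P i j
  indep : iIndepFun (fun (e : {e : Fin n × Fin n // e.1 < e.2}) ω => A ω e.1.1 e.1.2) μ

/-! ### The convex estimator -/

/-- The feasible set of the convex program. -/
def feasibleSet {n : ℕ} (M₁ M₂ : ℝ) (X : Matrix (Fin n) (Fin n) ℝ) :
    Set ((Fin n → ℝ) × ℝ × Matrix (Fin n) (Fin n) ℝ) :=
  {p | p.2.2 * centering n = p.2.2 ∧ p.2.2.PosSemidef ∧
    LogitBox M₁ M₂ (logitMatrix X p.1 p.2.1 p.2.2)}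

/-- The trace-penalized negative log-likelihood, summed over all pairs `(i, j)`. -/
def convexObjective {n : ℕ} (A X : Matrix (Fin n) (Fin n) ℝ) (lam : ℝ)
    (p : (Fin n → ℝ) × ℝ × Matrix (Fin n) (Fin n) ℝ) : ℝ :=
  -(∑ i, ∑ j, (A i j * logitMatrix X p.1 p.2.1 p.2.2 i j
      + Real.log (1 - Real.sigmoid (logitMatrix X p.1 p.2.1 p.2.2 i j))))
    + lam * p.2.2.trace

/-- `(α, β, G)` solves the convex program. -/
def IsConvexEstimator {n : ℕ} (A X : Matrix (Fin n) (Fin n) ℝ) (M₁ M₂ lam : ℝ)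
    (α : Fin n → ℝ) (β : ℝ) (G : Matrix (Fin n) (Fin n) ℝ) : Prop :=
  (α, β, G) ∈ feasibleSet M₁ M₂ X ∧
    IsMinOn (convexObjective A X lam) (feasibleSet M₁ M₂ X) (α, β, G)

/-- The rate `ψ_n² = e^{2 M₁} n k max{e^{-M₂}, (log n)/n}`. -/
def psiSq (n k : ℕ) (M₁ M₂ : ℝ) : ℝ :=
  Real.exp (2 * M₁) * n * k * max (Real.exp (-M₂)) (Real.log n / n)

/-- The tuning parameter `λ_n = C₀ √(max{n e^{-M₂}, log n})`. -/
def standardLambda (C₀ : ℝ) (n : ℕ) (M₂ : ℝ) : ℝ :=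
  C₀ * √(max (n * Real.exp (-M₂)) (Real.log n))

end LatentSpace

end

/-! Deterministic half. Logits bounded by `M₁` make the logistic loss strongly convex with modulus
of order `e^{-M₁}`, so optimality gives `e^{-M₁}‖Δ‖²/8 ≤ ⟨A - P, Δ⟩ + λ(Tr G - Tr Ĝ)` for the error
`Δ = Δa + Δb + Δg` (additive, covariate and latent parts). The noise pairs with `Δa` through rank
two, with `Δb` through the covariate direction, and with `Δg` through a projection onto at most `k`
dimensions plus a positive semidefinite remainder, half of which the trace penalty can afford. This
bounds the right side by `√k` times the sizes of the three parts, up to `‖G - B‖_*`. It remains to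
bound those sizes by `‖Δ‖`: `Δa` and `Δg` are orthogonal because of centering, and `Δb` is nearly
orthogonal to both, since large stable rank makes its operator norm tiny while `Δa` and `Δg` are
essentially of rank `O(k)`. This is `deterministic_bound`.

Probabilistic half. It must be shown that `‖A - P‖` is of order `√d`, where `d = max(n e^{-M₂}, log
n)`, without a spurious logarithm. The expected trace of the `2q`-th power of the noise is a sum
over closed walks using every edge at least twice. Grouping walks by shape compares this sum, when
`np ≤ q`, with the same unweighted count on the complete graph with `2q` vertices
(`sum_doubledWalk_le`). That count is not computed: it is bounded by the expected trace for a
bounded random matrix of size `2q` all of whose entry moments of order at least two are at least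
one, and the norm of that matrix is controlled by a net argument (`card_doubledWalk_le`). Markov's
inequality with `q` comparable to `d` finishes; Hoeffding's inequality handles the covariate
direction.

With a covariate the stated penalty term uses `√(n e^{-M₂})` rather than `√d`. When these differ,
`M₂ ≤ 3M₁/4` forces `n M₁ = O(e^{M₁})`, so the whole trace of `G` is absorbed by `ψ_n²`
(`exp_mul_sqrt_mul_nuclearNorm_le`). -/

namespace LatentSpace

open Matrix

variable {n : ℕ}

/-! ### Elementary facts about the matrix norms -/

theorem opNorm_nonneg (M : Matrix (Fin n) (Fin n) ℝ) : 0 ≤ opNorm M := norm_nonneg _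

theorem frobNorm_nonneg (M : Matrix (Fin n) (Fin n) ℝ) : 0 ≤ frobNorm M := Real.sqrt_nonneg _

theorem frobNorm_sq (M : Matrix (Fin n) (Fin n) ℝ) : frobNorm M ^ 2 = ∑ i, ∑ j, M i j ^ 2 :=
  Real.sq_sqrt (Finset.sum_nonneg fun _ _ => Finset.sum_nonneg fun _ _ => sq_nonneg _)

theorem traceInner_eq_sum (M N : Matrix (Fin n) (Fin n) ℝ) :
    traceInner M N = ∑ i, ∑ j, M i j * N i j := by
  simp only [traceInner, trace, diag_apply, mul_apply, transpose_apply]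
  exact Finset.sum_comm

theorem traceInner_self (M : Matrix (Fin n) (Fin n) ℝ) : traceInner M M = frobNorm M ^ 2 := by
  rw [traceInner_eq_sum, frobNorm_sq]
  simp only [sq]

theorem traceInner_comm (M N : Matrix (Fin n) (Fin n) ℝ) : traceInner M N = traceInner N M := by
  simp only [traceInner_eq_sum, mul_comm]

theorem traceInner_add_right (M N K : Matrix (Fin n) (Fin n) ℝ) :
    traceInner M (N + K) = traceInner M N + traceInner M K := by
  simp [traceInner, Matrix.mul_add, trace_add]

theorem traceInner_add_left (M N K : Matrix (Fin n) (Fin n) ℝ) :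
    traceInner (M + N) K = traceInner M K + traceInner N K := by
  simp [traceInner, Matrix.add_mul, trace_add]

theorem traceInner_sub_right (M N K : Matrix (Fin n) (Fin n) ℝ) :
    traceInner M (N - K) = traceInner M N - traceInner M K := by
  simp [traceInner, Matrix.mul_sub, trace_sub]

theorem traceInner_smul_right (c : ℝ) (M N : Matrix (Fin n) (Fin n) ℝ) :
    traceInner M (c • N) = c * traceInner M N := by
  simp [traceInner, trace_smul]

theorem frobNorm_add_sq (M N : Matrix (Fin n) (Fin n) ℝ) :
    frobNorm (M + N) ^ 2 = frobNorm M ^ 2 + 2 * traceInner M N + frobNorm N ^ 2 := by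
  simp only [← traceInner_self, traceInner_add_left, traceInner_add_right, traceInner_comm N M]
  ring

theorem frobNorm_smul (c : ℝ) (M : Matrix (Fin n) (Fin n) ℝ) :
    frobNorm (c • M) = |c| * frobNorm M := by
  rw [frobNorm, frobNorm, ← Real.sqrt_sq_eq_abs, ← Real.sqrt_mul (sq_nonneg c)]
  simp only [Matrix.smul_apply, smul_eq_mul, mul_pow, Finset.mul_sum]

theorem abs_traceInner_le (M N : Matrix (Fin n) (Fin n) ℝ) :
    |traceInner M N| ≤ frobNorm M * frobNorm N := by
  refine abs_le_of_sq_le_sq ?_ (mul_nonneg (frobNorm_nonneg M) (frobNorm_nonneg N))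
  rw [mul_pow, frobNorm_sq, frobNorm_sq, traceInner_eq_sum]
  simp only [← Finset.sum_product']
  exact Finset.sum_mul_sq_le_sq_mul_sq _ _ _

theorem frobNorm_transpose (M : Matrix (Fin n) (Fin n) ℝ) : frobNorm Mᵀ = frobNorm M := by
  simp only [frobNorm, transpose_apply]
  rw [Finset.sum_comm]

theorem frobNorm_eq_zero {M : Matrix (Fin n) (Fin n) ℝ} (h : frobNorm M = 0) : M = 0 := by
  have h2 := frobNorm_sq M
  rw [h, zero_pow two_ne_zero] at h2
  ext i j
  have h3 := (Finset.sum_eq_zero_iff_of_nonneg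
    fun i _ => Finset.sum_nonneg fun j _ => sq_nonneg (M i j)).1 h2.symm i (Finset.mem_univ i)
  have h4 := (Finset.sum_eq_zero_iff_of_nonneg fun j _ => sq_nonneg (M i j)).1 h3 j
    (Finset.mem_univ j)
  simpa using h4

theorem norm_toLp_eq (x : Fin n → ℝ) : ‖WithLp.toLp 2 x‖ = √(x ⬝ᵥ x) := by
  simp [EuclideanSpace.norm_eq, dotProduct, sq]

theorem dotProduct_self_nonneg_real (x : Fin n → ℝ) : 0 ≤ x ⬝ᵥ x :=
  Finset.sum_nonneg fun i _ => mul_self_nonneg (x i)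

theorem sqrt_mulVec_dotProduct_le (M : Matrix (Fin n) (Fin n) ℝ) (x : Fin n → ℝ) :
    √(M *ᵥ x ⬝ᵥ M *ᵥ x) ≤ opNorm M * √(x ⬝ᵥ x) := by
  rw [← norm_toLp_eq, ← norm_toLp_eq]
  exact (toEuclideanCLM (𝕜 := ℝ) M).le_opNorm (WithLp.toLp 2 x)

theorem mulVec_dotProduct_le (M : Matrix (Fin n) (Fin n) ℝ) (x : Fin n → ℝ) :
    M *ᵥ x ⬝ᵥ M *ᵥ x ≤ opNorm M ^ 2 * (x ⬝ᵥ x) := by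
  have h := pow_le_pow_left₀ (Real.sqrt_nonneg _) (sqrt_mulVec_dotProduct_le M x) 2
  rwa [mul_pow, Real.sq_sqrt (dotProduct_self_nonneg_real _),
    Real.sq_sqrt (dotProduct_self_nonneg_real _)] at h

theorem abs_dotProduct_mulVec_le (M : Matrix (Fin n) (Fin n) ℝ) (x y : Fin n → ℝ) :
    |x ⬝ᵥ M *ᵥ y| ≤ opNorm M * (√(x ⬝ᵥ x) * √(y ⬝ᵥ y)) := by
  have h1 : |x ⬝ᵥ M *ᵥ y| ≤ √(x ⬝ᵥ x) * √(M *ᵥ y ⬝ᵥ M *ᵥ y) := by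
    have := abs_real_inner_le_norm (WithLp.toLp 2 (M *ᵥ y)) (WithLp.toLp 2 x)
    rw [norm_toLp_eq, norm_toLp_eq, EuclideanSpace.inner_toLp_toLp] at this
    simpa [mul_comm] using this
  calc _ ≤ _ := h1
    _ ≤ √(x ⬝ᵥ x) * (opNorm M * √(y ⬝ᵥ y)) := by gcongr; exact sqrt_mulVec_dotProduct_le M y
    _ = _ := by ring

theorem opNorm_le_of_mulVec_le {M : Matrix (Fin n) (Fin n) ℝ} {c : ℝ} (hc : 0 ≤ c)
    (h : ∀ x : Fin n → ℝ, M *ᵥ x ⬝ᵥ M *ᵥ x ≤ c ^ 2 * (x ⬝ᵥ x)) : opNorm M ≤ c := by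
  refine ContinuousLinearMap.opNorm_le_bound _ hc fun v => ?_
  have h1 := Real.sqrt_le_sqrt (h v.ofLp)
  rw [Real.sqrt_mul (sq_nonneg c), Real.sqrt_sq hc, ← norm_toLp_eq, ← norm_toLp_eq] at h1
  exact h1

theorem opNorm_add_le (M N : Matrix (Fin n) (Fin n) ℝ) :
    opNorm (M + N) ≤ opNorm M + opNorm N := by
  rw [opNorm, map_add]
  exact norm_add_le _ _

theorem opNorm_smul (c : ℝ) (M : Matrix (Fin n) (Fin n) ℝ) :
    opNorm (c • M) = |c| * opNorm M := by
  rw [opNorm, map_smul, norm_smul, Real.norm_eq_abs, opNorm]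

theorem opNorm_transpose (M : Matrix (Fin n) (Fin n) ℝ) : opNorm Mᵀ = opNorm M := by
  rw [opNorm, ← conjTranspose_eq_transpose_of_trivial, ← star_eq_conjTranspose, map_star,
    opNorm, ContinuousLinearMap.star_eq_adjoint]
  exact ContinuousLinearMap.adjoint.norm_map _

theorem frobNorm_mul_le (M N : Matrix (Fin n) (Fin n) ℝ) :
    frobNorm (M * N) ≤ opNorm M * frobNorm N := by
  refine le_of_sq_le_sq ?_ (mul_nonneg (opNorm_nonneg M) (frobNorm_nonneg N))
  rw [mul_pow, ← frobNorm_transpose, ← frobNorm_transpose N, frobNorm_sq, frobNorm_sq,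
    Finset.mul_sum]
  refine Finset.sum_le_sum fun j _ => ?_
  have := mulVec_dotProduct_le M (N.col j)
  simpa [dotProduct, mulVec, mul_apply, sq] using this

theorem frobNorm_mul_le' (M N : Matrix (Fin n) (Fin n) ℝ) :
    frobNorm (M * N) ≤ frobNorm M * opNorm N := by
  rw [← frobNorm_transpose, transpose_mul, mul_comm (frobNorm M), ← opNorm_transpose N,
    ← frobNorm_transpose M]
  exact frobNorm_mul_le _ _

theorem opNorm_le_frobNorm (M : Matrix (Fin n) (Fin n) ℝ) : opNorm M ≤ frobNorm M := by
  refine opNorm_le_of_mulVec_le (frobNorm_nonneg M) fun x => ?_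
  rw [frobNorm_sq, dotProduct, Finset.sum_mul]
  refine Finset.sum_le_sum fun i _ => ?_
  have := Finset.sum_mul_sq_le_sq_mul_sq Finset.univ (M i) x
  simpa [mulVec, dotProduct, sq] using this

theorem frobNorm_one_sq : frobNorm (1 : Matrix (Fin n) (Fin n) ℝ) ^ 2 = n := by
  rw [← traceInner_self, traceInner]
  simp

theorem frobNorm_sq_le_opNorm_sq (M : Matrix (Fin n) (Fin n) ℝ) :
    frobNorm M ^ 2 ≤ n * opNorm M ^ 2 := by
  have h := pow_le_pow_left₀ (frobNorm_nonneg _) (frobNorm_mul_le M 1) 2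
  rw [mul_one, mul_pow, frobNorm_one_sq] at h
  linarith

theorem opNorm_diagonal_le {d : Fin n → ℝ} {c : ℝ} (hc : 0 ≤ c) (hd : ∀ i, |d i| ≤ c) :
    opNorm (diagonal d) ≤ c := by
  refine opNorm_le_of_mulVec_le hc fun x => ?_
  simp only [dotProduct, mulVec_diagonal, Finset.mul_sum]
  refine Finset.sum_le_sum fun i _ => ?_
  have : d i ^ 2 ≤ c ^ 2 := by rw [← sq_abs]; exact pow_le_pow_left₀ (abs_nonneg _) (hd i) 2
  nlinarith [mul_self_nonneg (x i)]

theorem traceInner_vecMulVec (M : Matrix (Fin n) (Fin n) ℝ) (x y : Fin n → ℝ) :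
    traceInner M (vecMulVec x y) = x ⬝ᵥ M *ᵥ y := by
  simp only [traceInner_eq_sum, vecMulVec_apply, dotProduct, mulVec, Finset.mul_sum]
  exact Finset.sum_congr rfl fun i _ => Finset.sum_congr rfl fun j _ => by ring

open scoped MatrixOrder in
theorem exists_eq_transpose_mul_self {S : Matrix (Fin n) (Fin n) ℝ} (hS : S.PosSemidef) :
    ∃ C : Matrix (Fin n) (Fin n) ℝ, S = Cᵀ * C := by
  obtain ⟨C, hC⟩ := CStarAlgebra.nonneg_iff_eq_star_mul_self.mp hS.nonneg
  exact ⟨C, by rw [hC, star_eq_conjTranspose, conjTranspose_eq_transpose_of_trivial]⟩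

/-- A positive semidefinite matrix pairs with `M` to at most `‖M‖ Tr S`. -/
theorem abs_traceInner_posSemidef_le (M : Matrix (Fin n) (Fin n) ℝ)
    {S : Matrix (Fin n) (Fin n) ℝ} (hS : S.PosSemidef) :
    |traceInner M S| ≤ opNorm M * S.trace := by
  obtain ⟨C, rfl⟩ := exists_eq_transpose_mul_self hS
  have h1 : traceInner M (Cᵀ * C) = ∑ k, C k ⬝ᵥ M *ᵥ C k := by
    rw [traceInner_comm, traceInner, transpose_mul, transpose_transpose, Matrix.mul_assoc,
      trace_mul_comm, Matrix.mul_assoc]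
    simp only [trace, diag_apply, mul_apply, transpose_apply, dotProduct, mulVec,
      Finset.mul_sum]
  have h2 : (Cᵀ * C).trace = ∑ k, C k ⬝ᵥ C k := by
    simp only [trace, diag_apply, mul_apply, transpose_apply, dotProduct]
    exact Finset.sum_comm
  rw [h1, h2, Finset.mul_sum]
  refine (Finset.abs_sum_le_sum_abs _ _).trans (Finset.sum_le_sum fun k _ => ?_)
  have := abs_dotProduct_mulVec_le M (C k) (C k)
  rwa [Real.mul_self_sqrt (dotProduct_self_nonneg_real _)] at this

/-! ### Orthogonal projections and best low-rank approximations -/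

/-- `P` is the matrix of an orthogonal projection. -/
structure IsOrthProj (P : Matrix (Fin n) (Fin n) ℝ) : Prop where
  symm : Pᵀ = P
  idem : P * P = P

theorem IsOrthProj.compl {P : Matrix (Fin n) (Fin n) ℝ} (h : IsOrthProj P) :
    IsOrthProj (1 - P) where
  symm := by rw [transpose_sub, transpose_one, h.symm]
  idem := by simp [Matrix.sub_mul, Matrix.mul_sub, h.idem]

theorem IsOrthProj.opNorm_le_one {P : Matrix (Fin n) (Fin n) ℝ} (h : IsOrthProj P) :
    opNorm P ≤ 1 := by
  refine opNorm_le_of_mulVec_le zero_le_one fun x => ?_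
  have h1 : (1 - P) *ᵥ x ⬝ᵥ (1 - P) *ᵥ x = x ⬝ᵥ x - P *ᵥ x ⬝ᵥ P *ᵥ x := by
    have key : ∀ R : Matrix (Fin n) (Fin n) ℝ, IsOrthProj R →
        R *ᵥ x ⬝ᵥ R *ᵥ x = x ⬝ᵥ R *ᵥ x := fun R hR => by
      rw [dotProduct_mulVec, ← mulVec_transpose, hR.symm, mulVec_mulVec, hR.idem, dotProduct_comm]
    rw [key _ h.compl, key _ h, sub_mulVec, one_mulVec, dotProduct_sub]
  have h2 := dotProduct_self_nonneg_real ((1 - P) *ᵥ x)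
  linarith

/-- The projection onto the column space. Its squared Frobenius norm is its trace, hence the rank;
this is how `√k` enters all later estimates. -/
theorem exists_orthProj_range (B : Matrix (Fin n) (Fin n) ℝ) :
    ∃ P : Matrix (Fin n) (Fin n) ℝ, IsOrthProj P ∧ P * B = B ∧ frobNorm P ^ 2 = B.rank ∧
      P.rank = B.rank := by
  set K := LinearMap.range (toEuclideanLin B) with hK
  have hB : B.rank = Module.finrank ℝ K := by
    rw [hK, toEuclideanLin_eq_toLin_orthonormal]
    exact rank_eq_finrank_range_toLin _ _ _
  set P := (toEuclideanCLM (n := Fin n) (𝕜 := ℝ)).symm K.starProjection with hP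
  have hP' : toEuclideanCLM (n := Fin n) (𝕜 := ℝ) P = K.starProjection := by simp [hP]
  have hlin : toEuclideanLin P = K.starProjection.toLinearMap := by
    rw [← hP', coe_toEuclideanCLM_eq_toEuclideanLin]
  have hproj : LinearMap.IsProj K K.starProjection.toLinearMap :=
    ⟨fun x => K.starProjection_apply_mem x, fun x hx => K.starProjection_eq_self_iff.2 hx⟩
  have hinj : Function.Injective (toEuclideanCLM (n := Fin n) (𝕜 := ℝ)) :=
    (toEuclideanCLM (n := Fin n) (𝕜 := ℝ)).injective
  have horth : IsOrthProj P := by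
    refine ⟨hinj ?_, hinj ?_⟩
    · rw [← conjTranspose_eq_transpose_of_trivial, ← star_eq_conjTranspose, map_star, hP']
      exact isSelfAdjoint_starProjection K
    · rw [map_mul, hP']
      exact K.isIdempotentElem_starProjection
  refine ⟨P, horth, ?_, ?_, ?_⟩
  · apply hinj
    rw [map_mul, hP']
    ext1 v
    exact K.starProjection_eq_self_iff.2 ⟨v, rfl⟩
  · rw [← traceInner_self, traceInner, horth.symm, horth.idem, hB, ← hproj.trace, ← hlin,
      toEuclideanLin_eq_toLin_orthonormal, LinearMap.trace_eq_matrix_trace ℝ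
        (EuclideanSpace.basisFun (Fin n) ℝ).toBasis, LinearMap.toMatrix_toLin]
  · have : P.rank = Module.finrank ℝ (LinearMap.range (toEuclideanLin P)) := by
      rw [toEuclideanLin_eq_toLin_orthonormal]
      exact rank_eq_finrank_range_toLin _ _ _
    rw [this, hB, hlin]
    exact congrArg (fun L : Submodule ℝ (EuclideanSpace ℝ (Fin n)) => Module.finrank ℝ L)
      K.range_starProjection

/-- The residual of a best rank-`k` approximation is a projection of the matrix. -/
theorem IsBestRankApprox.exists_orthProj {k : ℕ} {G B : Matrix (Fin n) (Fin n) ℝ}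
    (h : IsBestRankApprox k G B) :
    ∃ P : Matrix (Fin n) (Fin n) ℝ, IsOrthProj P ∧ frobNorm P ^ 2 ≤ k ∧ G - B = (1 - P) * G := by
  obtain ⟨P, hP, hPB, hfr, hrk⟩ := exists_orthProj_range B
  refine ⟨P, hP, by rw [hfr]; exact_mod_cast h.1, ?_⟩
  -- Pythagoras: the two summands are orthogonal, and `P * G` is a competitor of rank at most `k`
  -- whose residual is the first summand alone. Optimality of `B` kills the second.
  have h1 : G - B = (1 - P) * G + P * (G - B) := by
    rw [Matrix.mul_sub, hPB, Matrix.sub_mul, Matrix.one_mul]; abel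
  have h2 : traceInner ((1 - P) * G) (P * (G - B)) = 0 := by
    rw [traceInner, transpose_mul, hP.compl.symm, Matrix.mul_assoc, ← Matrix.mul_assoc (1 - P),
      Matrix.sub_mul, hP.idem]
    simp
  have h3 := frobNorm_add_sq ((1 - P) * G) (P * (G - B))
  rw [← h1, h2] at h3
  have h4 := h.2 (P * G) ((rank_mul_le_left P G).trans (hrk.trans_le h.1))
  have h5 : G - P * G = (1 - P) * G := by rw [Matrix.sub_mul, Matrix.one_mul]
  rw [h5] at h4
  have h6 := pow_le_pow_left₀ (frobNorm_nonneg _) h4 2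
  have h7 : frobNorm (P * (G - B)) = 0 := by nlinarith [sq_nonneg (frobNorm (P * (G - B)))]
  rw [h1, frobNorm_eq_zero h7, add_zero]

/-! ### The nuclear norm -/

/-- The basis consists of right singular vectors, that is, eigenvectors of `MᵀM`. -/
theorem exists_orthonormalBasis_nuclearNorm (M : Matrix (Fin n) (Fin n) ℝ) :
    ∃ b : OrthonormalBasis (Fin n) ℝ (EuclideanSpace ℝ (Fin n)),
      nuclearNorm M = ∑ i, ‖toEuclideanLin M (b i)‖ ∧
      ∀ i j, i ≠ j → inner ℝ (toEuclideanLin M (b i)) (toEuclideanLin M (b j)) = 0 := by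
  have hn : Module.finrank ℝ (EuclideanSpace ℝ (Fin n)) = n := by simp
  set T := toEuclideanLin M
  set b := T.isSymmetric_adjoint_comp_self.eigenvectorBasis hn with hb
  have key : ∀ i j, inner ℝ (T (b i)) (T (b j)) =
      T.isSymmetric_adjoint_comp_self.eigenvalues hn i * inner ℝ (b i) (b j) := fun i j => by
    rw [← LinearMap.adjoint_inner_left, ← LinearMap.comp_apply, hb,
      LinearMap.IsSymmetric.apply_eigenvectorBasis, inner_smul_left]
    simp
  refine ⟨b, ?_, fun i j hij => ?_⟩
  · rw [nuclearNorm, Finset.sum_range]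
    refine Finset.sum_congr rfl fun i _ => ?_
    rw [T.singularValues_fin hn, norm_eq_sqrt_real_inner, key, real_inner_self_eq_norm_sq,
      b.norm_eq_one]
    simp
  · rw [key, b.inner_eq_zero hij, mul_zero]

theorem trace_le_nuclearNorm (M : Matrix (Fin n) (Fin n) ℝ) : M.trace ≤ nuclearNorm M := by
  obtain ⟨b, hb, -⟩ := exists_orthonormalBasis_nuclearNorm M
  have h : M.trace = ∑ i, inner ℝ (b i) (toEuclideanLin M (b i)) := by
    rw [← LinearMap.trace_eq_sum_inner, LinearMap.trace_eq_matrix_trace ℝ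
        (EuclideanSpace.basisFun (Fin n) ℝ).toBasis, toEuclideanLin_eq_toLin_orthonormal,
        LinearMap.toMatrix_toLin]
  rw [h, hb]
  refine Finset.sum_le_sum fun i _ => (real_inner_le_norm _ _).trans ?_
  rw [b.norm_eq_one, one_mul]

theorem nuclearNorm_nonneg (M : Matrix (Fin n) (Fin n) ℝ) : 0 ≤ nuclearNorm M :=
  Finset.sum_nonneg fun _ _ => LinearMap.singularValues_nonneg _ _

/-- Bessel's inequality for the rows of a matrix. -/
theorem sum_norm_sq_le_of_orthogonal (C : Matrix (Fin n) (Fin n) ℝ)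
    (u : Fin n → EuclideanSpace ℝ (Fin n)) (h1 : ∀ i, u i ≠ 0 → ‖u i‖ = 1)
    (h2 : ∀ i j, i ≠ j → inner ℝ (u i) (u j) = 0) :
    ∑ i, ‖toEuclideanLin C (u i)‖ ^ 2 ≤ frobNorm C ^ 2 := by
  have hb : ∀ r : EuclideanSpace ℝ (Fin n), ∑ i, inner ℝ (u i) r ^ 2 ≤ ‖r‖ ^ 2 := fun r => by
    have ho : Orthonormal ℝ fun i : {i // u i ≠ 0} => u i :=
      ⟨fun i => h1 i i.2, fun i j hij => h2 i j fun h => hij (Subtype.ext h)⟩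
    have := ho.sum_inner_products_le r (s := Finset.univ)
    refine le_trans (le_of_eq ?_) this
    rw [← Fintype.sum_subtype_add_sum_subtype (fun i => u i ≠ 0) fun i => inner ℝ (u i) r ^ 2,
      Fintype.sum_eq_zero (fun i : {i // ¬u i ≠ 0} => inner ℝ (u i) r ^ 2)
        fun i => by simp [not_not.1 i.2], add_zero]
    simp only [Real.norm_eq_abs, sq_abs]
  have hr : ∀ i, ‖toEuclideanLin C (u i)‖ ^ 2 =
      ∑ k, inner ℝ (u i) (WithLp.toLp 2 (C k) : EuclideanSpace ℝ (Fin n)) ^ 2 := fun i => by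
    rw [EuclideanSpace.norm_sq_eq]
    refine Finset.sum_congr rfl fun k _ => ?_
    rw [Real.norm_eq_abs, sq_abs, toLpLin_apply]
    simp [mulVec, dotProduct, PiLp.inner_apply]
  simp only [hr]
  rw [Finset.sum_comm, frobNorm_sq]
  refine Finset.sum_le_sum fun k _ => (hb _).trans (le_of_eq ?_)
  simp [EuclideanSpace.norm_sq_eq]

/-- Projecting a positive semidefinite matrix does not push its nuclear norm above the trace. -/
theorem nuclearNorm_proj_mul_le {Q G : Matrix (Fin n) (Fin n) ℝ} (hQ : IsOrthProj Q)
    (hG : G.PosSemidef) : nuclearNorm (Q * G) ≤ G.trace := by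
  obtain ⟨C, rfl⟩ := exists_eq_transpose_mul_self hG
  obtain ⟨b, hb, ho⟩ := exists_orthonormalBasis_nuclearNorm (Q * (Cᵀ * C))
  set T := toEuclideanLin (Q * (Cᵀ * C)) with hT
  -- These are the left singular vectors; `u i = 0` when `T (b i) = 0`, because `0⁻¹ = 0`, which is
  -- why the Bessel bound admits zero vectors. With `G = CᵀC`, each singular value becomes `⟨CQ uᵢ,
  -- C bᵢ⟩`, and AM-GM followed by Bessel bounds the sum by `‖C‖_F² = Tr G`.
  set u : Fin n → EuclideanSpace ℝ (Fin n) := fun i => ‖T (b i)‖⁻¹ • T (b i) with hu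
  have hC : (Cᵀ * C).trace = frobNorm C ^ 2 := by rw [← traceInner_self, traceInner]
  have hCQ : frobNorm (C * Q) ^ 2 ≤ frobNorm C ^ 2 := by
    refine pow_le_pow_left₀ (frobNorm_nonneg _) ((frobNorm_mul_le' _ _).trans ?_) 2
    exact mul_le_of_le_one_right (frobNorm_nonneg _) hQ.opNorm_le_one
  have hu1 := sum_norm_sq_le_of_orthogonal (C * Q) u (fun i hi => by
    have : T (b i) ≠ 0 := fun h => hi (by simp [hu, h])
    simp [hu, norm_smul, norm_ne_zero_iff.2 this]) (fun i j hij => by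
    simp [hu, inner_smul_left, inner_smul_right, ho i j hij])
  have hb1 := sum_norm_sq_le_of_orthogonal C b (fun i _ => b.norm_eq_one i)
    (fun i j hij => b.inner_eq_zero hij)
  have hin : ∀ i, ‖T (b i)‖ = inner ℝ (toEuclideanLin (C * Q) (u i)) (toEuclideanLin C (b i)) := by
    intro i
    have e : T (b i) = toEuclideanLin (C * Q)ᵀ (toEuclideanLin C (b i)) := by
      rw [hT, ← Matrix.mul_assoc, transpose_mul, hQ.symm]
      simp [toLpLin_apply, mulVec_mulVec, Matrix.mul_assoc]
    have : inner ℝ (toEuclideanLin (C * Q) (u i)) (toEuclideanLin C (b i))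
        = inner ℝ (u i) (T (b i)) := by
      rw [e, ← conjTranspose_eq_transpose_of_trivial, toEuclideanLin_conjTranspose_eq_adjoint,
        LinearMap.adjoint_inner_right]
    rw [this, hu, inner_smul_left, real_inner_self_eq_norm_sq]
    by_cases h0 : ‖T (b i)‖ = 0
    · simp [h0]
    · simp; field_simp
  rw [hb, hC]
  calc ∑ i, ‖T (b i)‖
      ≤ ∑ i, (‖toEuclideanLin (C * Q) (u i)‖ ^ 2 + ‖toEuclideanLin C (b i)‖ ^ 2) / 2 := by
        refine Finset.sum_le_sum fun i _ => ?_
        rw [hin]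
        refine (real_inner_le_norm _ _).trans ?_
        nlinarith [sq_nonneg (‖toEuclideanLin (C * Q) (u i)‖ - ‖toEuclideanLin C (b i)‖)]
    _ ≤ frobNorm C ^ 2 := by
        rw [← Finset.sum_div, Finset.sum_add_distrib]
        linarith

/-! ### Strong convexity of the logistic loss -/

/-- The product equals `1 / (2 + e^x + e^{-x})`, and the denominator is at most `2 + 2e^M ≤ 4e^M`.
-/
theorem exp_neg_div_le_sigmoid_mul {M x : ℝ} (hx : |x| ≤ M) :
    Real.exp (-M) / 4 ≤ Real.sigmoid x * (1 - Real.sigmoid x) := by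
  obtain ⟨h1, h2⟩ := abs_le.1 hx
  have hM : 0 ≤ M := (abs_nonneg x).trans hx
  rw [← Real.sigmoid_neg, Real.sigmoid_def, Real.sigmoid_def, neg_neg, ← mul_inv,
    div_eq_mul_inv, Real.exp_neg M, ← mul_inv]
  apply inv_anti₀ (by positivity)
  have h3 : (1 + Real.exp (-x)) * (1 + Real.exp x) = 2 + Real.exp x + Real.exp (-x) := by
    have : Real.exp (-x) * Real.exp x = 1 := by rw [← Real.exp_add]; simp
    linear_combination this
  rw [h3]
  have h4 := Real.exp_le_exp.2 h2
  have h5 := Real.exp_le_exp.2 (neg_le.1 h1)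
  have h6 := Real.one_le_exp hM
  linarith

theorem hasDerivAt_neg_log_one_sub_sigmoid (x : ℝ) :
    HasDerivAt (fun y => -Real.log (1 - Real.sigmoid y)) (Real.sigmoid x) x := by
  have h0 : 1 - Real.sigmoid x ≠ 0 := (sub_pos.2 (Real.sigmoid_lt_one x)).ne'
  have h := (((Real.hasDerivAt_sigmoid x).const_sub 1).log h0).neg
  convert! h using 1
  field_simp

/-- Subtracting `(c/2) z²`, with `c` the lower bound for the second derivative, leaves a convex
function on `[-M, M]`; the claim is its tangent line inequality at `x`. -/
theorem logistic_strong_convexity {M x y : ℝ} (hx : |x| ≤ M) (hy : |y| ≤ M) :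
    Real.exp (-M) / 8 * (y - x) ^ 2 ≤
      (-Real.log (1 - Real.sigmoid y)) - (-Real.log (1 - Real.sigmoid x))
        - Real.sigmoid x * (y - x) := by
  set c := Real.exp (-M) / 4 with hc
  set f : ℝ → ℝ := fun z => -Real.log (1 - Real.sigmoid z) - c / 2 * z ^ 2 with hf
  have hder : ∀ z, HasDerivAt f (Real.sigmoid z - c * z) z := fun z => by
    have := (hasDerivAt_neg_log_one_sub_sigmoid z).sub (((hasDerivAt_id z).pow 2).const_mul (c / 2))
    convert! this using 1
    simp; ring
  have hder2 : ∀ z, HasDerivAt (fun z => Real.sigmoid z - c * z)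
      (Real.sigmoid z * (1 - Real.sigmoid z) - c) z := fun z => by
    have := (Real.hasDerivAt_sigmoid z).sub ((hasDerivAt_id z).const_mul c)
    convert! this using 1
    simp
  have hd1 : deriv f = fun z => Real.sigmoid z - c * z := funext fun z => (hder z).deriv
  have hconv : ConvexOn ℝ (Set.Icc (-M) M) f := by
    refine convexOn_of_deriv2_nonneg (convex_Icc _ _)
      (fun z _ => (hder z).continuousAt.continuousWithinAt)
      (fun z _ => (hder z).differentiableAt.differentiableWithinAt)
      (by rw [hd1]; exact fun z _ => (hder2 z).differentiableAt.differentiableWithinAt) ?_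
    intro z hz
    rw [interior_Icc] at hz
    rw [Function.iterate_succ, Function.iterate_one, Function.comp_apply, hd1, (hder2 z).deriv]
    exact sub_nonneg.2 (exp_neg_div_le_sigmoid_mul (abs_le.2 ⟨hz.1.le, hz.2.le⟩))
  have htan : f x + (Real.sigmoid x - c * x) * (y - x) ≤ f y := by
    rcases lt_trichotomy x y with h | h | h
    · have := hconv.le_slope_of_hasDerivAt (abs_le.1 hx) (abs_le.1 hy) h (hder x)
      rw [slope_def_field, le_div_iff₀ (sub_pos.2 h)] at this
      linarith
    · simp [h]
    · have := hconv.slope_le_of_hasDerivAt (abs_le.1 hy) (abs_le.1 hx) h (hder x)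
      rw [slope_def_field, div_le_iff₀ (sub_pos.2 h)] at this
      linarith
  simp only [hf] at htan
  have : Real.exp (-M) / 8 = c / 2 := by rw [hc]; ring
  rw [this]
  nlinarith

/-! ### The additive, covariate and low-rank components of a logit matrix -/

/-- The matrix `x 1ᵀ + 1 xᵀ`. -/
def addMatrix (x : Fin n → ℝ) : Matrix (Fin n) (Fin n) ℝ := Matrix.of fun i j => x i + x j

theorem logitMatrix_sub (X : Matrix (Fin n) (Fin n) ℝ) (α α' : Fin n → ℝ) (β β' : ℝ)
    (G G' : Matrix (Fin n) (Fin n) ℝ) :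
    logitMatrix X α' β' G' - logitMatrix X α β G =
      addMatrix (α' - α) + (β' - β) • X + (G' - G) := by
  ext i j
  simp [logitMatrix, addMatrix]
  ring

theorem centering_transpose : (centering n)ᵀ = centering n := by
  ext i j
  simp [centering, one_apply, eq_comm]

theorem sum_col_eq_zero_of_centering_mul (hn : 1 ≤ n) {G : Matrix (Fin n) (Fin n) ℝ}
    (h : centering n * G = G) (j : Fin n) : ∑ i, G i j = 0 := by
  have h1 := congrFun (congrFun h ⟨0, hn⟩) j
  simp only [centering, Matrix.sub_mul, Matrix.one_mul, Matrix.sub_apply, Matrix.smul_mul,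
    Matrix.smul_apply, smul_eq_mul] at h1
  simp only [mul_apply, of_apply, one_mul] at h1
  have hn' : (n : ℝ) ≠ 0 := by positivity
  have h2 : 1 / (n : ℝ) * ∑ i, G i j = 0 := by linarith
  simpa [hn'] using h2

theorem sum_row_eq_zero_of_mul_centering (hn : 1 ≤ n) {G : Matrix (Fin n) (Fin n) ℝ}
    (h : G * centering n = G) (i : Fin n) : ∑ j, G i j = 0 := by
  have h1 : centering n * Gᵀ = Gᵀ := by
    rw [← centering_transpose, ← transpose_mul, h]
  exact sum_col_eq_zero_of_centering_mul hn h1 i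

theorem PosSemidef.transpose_eq_self {G : Matrix (Fin n) (Fin n) ℝ} (h : G.PosSemidef) :
    Gᵀ = G := by
  rw [← conjTranspose_eq_transpose_of_trivial]
  exact h.isHermitian

theorem centering_mul_iff {G : Matrix (Fin n) (Fin n) ℝ} (h : G.PosSemidef) :
    centering n * G = G ↔ G * centering n = G := by
  have hs := PosSemidef.transpose_eq_self h
  constructor
  · intro h1
    rw [← hs, ← centering_transpose, ← transpose_mul, hs, h1, hs]
  · intro h1
    rw [← hs, ← centering_transpose, ← transpose_mul, hs, h1, hs]

/-- The reason for the centering constraint: it makes the additive and latent parts of the error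
orthogonal. -/
theorem traceInner_addMatrix_eq_zero {G : Matrix (Fin n) (Fin n) ℝ} (x : Fin n → ℝ)
    (h1 : ∀ i, ∑ j, G i j = 0) (h2 : ∀ j, ∑ i, G i j = 0) : traceInner (addMatrix x) G = 0 := by
  simp only [traceInner_eq_sum, addMatrix, of_apply, add_mul, Finset.sum_add_distrib]
  rw [Finset.sum_comm (f := fun i j => x j * G i j)]
  simp [← Finset.mul_sum, h1, h2]

theorem addMatrix_eq (x : Fin n → ℝ) : addMatrix x = vecMulVec x 1 + vecMulVec 1 x := by
  ext i j
  simp [addMatrix]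

theorem frobNorm_addMatrix_sq (x : Fin n → ℝ) :
    frobNorm (addMatrix x) ^ 2 = 2 * n * (x ⬝ᵥ x) + 2 * (∑ i, x i) ^ 2 := by
  have h : ∀ i j, (x i + x j) ^ 2 = x i * x i + 2 * (x i * x j) + x j * x j := fun i j => by ring
  simp only [frobNorm_sq, addMatrix, of_apply, h, Finset.sum_add_distrib, ← Finset.mul_sum,
    Finset.sum_const, Finset.card_univ, Fintype.card_fin, nsmul_eq_mul, ← Finset.sum_mul,
    dotProduct]
  have h2 : ∑ i, x i * (n * x i) = n * ∑ i, x i * x i := by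
    simp only [mul_left_comm _ (n : ℝ), ← Finset.mul_sum]
  rw [h2]
  ring

/-- The additive matrix is a sum of two rank-one terms, each of Frobenius norm `√n ‖x‖`, which is at
most the Frobenius norm of the sum. Its nuclear norm is therefore comparable to its Frobenius norm,
with no factor of `√k`. -/
theorem abs_traceInner_addMatrix_le (E : Matrix (Fin n) (Fin n) ℝ) (x : Fin n → ℝ) :
    |traceInner E (addMatrix x)| ≤ 2 * opNorm E * frobNorm (addMatrix x) := by
  have h0 : √(x ⬝ᵥ x) * √((1 : Fin n → ℝ) ⬝ᵥ 1) ≤ frobNorm (addMatrix x) := by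
    rw [← Real.sqrt_mul (dotProduct_self_nonneg_real x)]
    refine Real.sqrt_le_iff.2 ⟨frobNorm_nonneg _, ?_⟩
    rw [frobNorm_addMatrix_sq]
    have : (1 : Fin n → ℝ) ⬝ᵥ 1 = n := by simp
    rw [this]
    nlinarith [mul_nonneg (Nat.cast_nonneg (α := ℝ) n) (dotProduct_self_nonneg_real x),
      sq_nonneg (∑ i, x i)]
  rw [addMatrix_eq, traceInner_add_right, traceInner_vecMulVec, traceInner_vecMulVec,
    ← addMatrix_eq]
  have h1 := abs_dotProduct_mulVec_le E x 1
  have h2 := abs_dotProduct_mulVec_le E 1 x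
  rw [mul_comm (√((1 : Fin n → ℝ) ⬝ᵥ 1))] at h2
  have h3 := mul_le_mul_of_nonneg_left h0 (opNorm_nonneg E)
  exact (abs_add_le _ _).trans (by linarith)

theorem traceInner_proj_mul {P : Matrix (Fin n) (Fin n) ℝ} (hP : Pᵀ = P)
    (E D : Matrix (Fin n) (Fin n) ℝ) : traceInner E (P * D) = traceInner (P * E) D := by
  rw [traceInner, traceInner, transpose_mul, hP, Matrix.mul_assoc]

theorem traceInner_mul_proj {P : Matrix (Fin n) (Fin n) ℝ} (hP : Pᵀ = P)
    (E D : Matrix (Fin n) (Fin n) ℝ) : traceInner E (D * P) = traceInner (E * P) D := by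
  rw [traceInner, traceInner, transpose_mul, hP, ← Matrix.mul_assoc, trace_mul_comm,
    Matrix.mul_assoc]

theorem PosSemidef.compress {Q G : Matrix (Fin n) (Fin n) ℝ} (hQ : Qᵀ = Q) (hG : G.PosSemidef) :
    (Q * G * Q).PosSemidef := by
  have := hG.mul_mul_conjTranspose_same Q
  rwa [conjTranspose_eq_transpose_of_trivial, hQ] at this

/-- Pairing with a difference of positive semidefinite matrices, split along a low-rank
projection. -/
theorem abs_traceInner_sub_le {P G G' : Matrix (Fin n) (Fin n) ℝ} {κ : ℝ} (hP : IsOrthProj P)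
    (hκ : frobNorm P ≤ κ) (hG : G.PosSemidef) (hG' : G'.PosSemidef)
    (E : Matrix (Fin n) (Fin n) ℝ) :
    |traceInner E (G' - G)| ≤ opNorm E * (2 * κ * frobNorm (G' - G) +
      ((1 - P) * G' * (1 - P)).trace + ((1 - P) * G * (1 - P)).trace) := by
  set Q := 1 - P with hQdef
  have hQ : IsOrthProj Q := hP.compl
  set D := G' - G with hD
  -- The first two pieces contain a factor `P`, so pairing them with `E` costs `‖P‖_F ‖E‖` in
  -- Frobenius norm. The last is a difference of positive semidefinite matrices, each paying only
  -- its trace.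
  have hdec : D = P * D + Q * D * P + (Q * G' * Q - Q * G * Q) := by
    have : Q * G' * Q - Q * G * Q = Q * D * Q := by
      rw [hD, Matrix.mul_sub Q, Matrix.sub_mul (Q * G')]
    rw [this, add_assoc, ← Matrix.mul_add]
    have h1 : P + Q = 1 := by rw [hQdef]; abel
    rw [h1, Matrix.mul_one, ← Matrix.add_mul, h1, Matrix.one_mul]
  have hg := frobNorm_nonneg D
  have hE := opNorm_nonneg E
  have e1 : |traceInner E (P * D)| ≤ opNorm E * (κ * frobNorm D) := by
    rw [traceInner_proj_mul hP.symm]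
    refine (abs_traceInner_le _ _).trans ?_
    have := (frobNorm_mul_le' P E).trans (mul_le_mul_of_nonneg_right hκ hE)
    nlinarith
  have e2 : |traceInner E (Q * D * P)| ≤ opNorm E * (κ * frobNorm D) := by
    rw [traceInner_mul_proj hP.symm, traceInner_proj_mul hQ.symm]
    refine (abs_traceInner_le _ _).trans ?_
    have h1 : frobNorm (Q * (E * P)) ≤ opNorm E * κ := by
      calc _ ≤ opNorm Q * frobNorm (E * P) := frobNorm_mul_le _ _
        _ ≤ 1 * frobNorm (E * P) := by
          gcongr
          · exact frobNorm_nonneg _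
          · exact hQ.opNorm_le_one
        _ ≤ opNorm E * frobNorm P := by rw [one_mul]; exact frobNorm_mul_le _ _
        _ ≤ _ := by gcongr
    nlinarith
  have e3 := abs_traceInner_posSemidef_le E (PosSemidef.compress hQ.symm hG')
  have e4 := abs_traceInner_posSemidef_le E (PosSemidef.compress hQ.symm hG)
  have e5 : traceInner E D = traceInner E (P * D) + traceInner E (Q * D * P) +
      (traceInner E (Q * G' * Q) - traceInner E (Q * G * Q)) := by
    conv_lhs => rw [hdec]
    rw [traceInner_add_right, traceInner_add_right, traceInner_sub_right]
  rw [e5]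
  rw [abs_le] at *
  constructor <;> nlinarith

/-- Compressing by `1 - P` removes exactly `⟨P, H⟩` from `Tr H`, so the trace difference is governed
by `⟨P, G' - G⟩` and Cauchy–Schwarz. The negative compressed trace is what later offsets the noise.
-/
theorem trace_sub_le {P G G' : Matrix (Fin n) (Fin n) ℝ} {κ : ℝ} (hP : IsOrthProj P)
    (hκ : frobNorm P ≤ κ) :
    G.trace - G'.trace ≤ κ * frobNorm (G' - G) - ((1 - P) * G' * (1 - P)).trace +
      ((1 - P) * G * (1 - P)).trace := by
  have key : ∀ H : Matrix (Fin n) (Fin n) ℝ,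
      ((1 - P) * H * (1 - P)).trace = H.trace - traceInner P H := fun H => by
    rw [trace_mul_comm, ← Matrix.mul_assoc, hP.compl.idem, Matrix.sub_mul, trace_sub,
      Matrix.one_mul, traceInner, hP.symm]
  rw [key, key]
  have h1 := (abs_traceInner_le P (G' - G)).trans
    (mul_le_mul_of_nonneg_right hκ (frobNorm_nonneg _))
  rw [traceInner_sub_right, abs_le] at h1
  linarith

/-! ### The deterministic error bound -/

theorem LogitBox.abs_apply_le {M₁ M₂ : ℝ} {Θ : Matrix (Fin n) (Fin n) ℝ} (h : LogitBox M₁ M₂ Θ)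
    (h0 : 0 ≤ M₂) (h1 : M₂ ≤ M₁) (i j : Fin n) : |Θ i j| ≤ M₁ := by
  by_cases hij : i = j
  · exact hij ▸ h.2 i
  · exact abs_le.2 ⟨(h.1 i j hij).1, by linarith [(h.1 i j hij).2]⟩

/-- Optimality of the estimator and strong convexity of the loss. -/
theorem basic_inequality {M₁ M₂ lam : ℝ} {X A : Matrix (Fin n) (Fin n) ℝ}
    {α αhat : Fin n → ℝ} {β βhat : ℝ} {G Ghat : Matrix (Fin n) (Fin n) ℝ}
    (h0 : 0 ≤ M₂) (h1 : M₂ ≤ M₁) (hG : G.PosSemidef) (hcG : centering n * G = G)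
    (hbox : LogitBox M₁ M₂ (logitMatrix X α β G))
    (hest : IsConvexEstimator A X M₁ M₂ lam αhat βhat Ghat) :
    Real.exp (-M₁) / 8 *
        frobNorm (logitMatrix X αhat βhat Ghat - logitMatrix X α β G) ^ 2 ≤
      traceInner (A - probMatrix (logitMatrix X α β G))
        (logitMatrix X αhat βhat Ghat - logitMatrix X α β G) + lam * (G.trace - Ghat.trace) := by
  obtain ⟨⟨-, -, hbox'⟩, hmin⟩ := hest
  have hmem : (α, β, G) ∈ feasibleSet M₁ M₂ X := ⟨(centering_mul_iff hG).1 hcG, hG, hbox⟩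
  have hopt := hmin hmem
  simp only [convexObjective, Set.mem_ofPred_eq] at hopt
  have hbox' : LogitBox M₁ M₂ (logitMatrix X αhat βhat Ghat) := hbox'
  set Θ := logitMatrix X α β G
  set Θ' := logitMatrix X αhat βhat Ghat
  have hsum : Real.exp (-M₁) / 8 * frobNorm (Θ' - Θ) ^ 2 ≤
      ∑ i, ∑ j, ((-Real.log (1 - Real.sigmoid (Θ' i j))) - (-Real.log (1 - Real.sigmoid (Θ i j)))
        - Real.sigmoid (Θ i j) * (Θ' i j - Θ i j)) := by
    rw [frobNorm_sq, Finset.mul_sum]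
    refine Finset.sum_le_sum fun i _ => ?_
    rw [Finset.mul_sum]
    refine Finset.sum_le_sum fun j _ => ?_
    exact logistic_strong_convexity (hbox.abs_apply_le h0 h1 i j)
      (hbox'.abs_apply_le h0 h1 i j)
  have heq : ∑ i, ∑ j, ((-Real.log (1 - Real.sigmoid (Θ' i j)))
      - (-Real.log (1 - Real.sigmoid (Θ i j))) - Real.sigmoid (Θ i j) * (Θ' i j - Θ i j)) =
      traceInner (A - probMatrix Θ) (Θ' - Θ)
        - (∑ i, ∑ j, (A i j * Θ' i j + Real.log (1 - Real.sigmoid (Θ' i j))))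
        + ∑ i, ∑ j, (A i j * Θ i j + Real.log (1 - Real.sigmoid (Θ i j))) := by
    rw [traceInner_eq_sum]
    simp only [← Finset.sum_sub_distrib, ← Finset.sum_add_distrib]
    refine Finset.sum_congr rfl fun i _ => Finset.sum_congr rfl fun j _ => ?_
    simp only [Matrix.sub_apply, probMatrix, of_apply]
    ring
  rw [heq] at hsum
  linarith

/-- The final computation: `a, b, g` stand for the sizes of the three components of the error,
and `D` for the size of their sum. -/
theorem sq_le_of_basic_inequality {a b g D ρ κ lam L T : ℝ} (hD : 0 ≤ D)
    (hκ : 0 < κ) (hlam : 0 < lam) (hL : 0 < L) (hρ : 0 ≤ ρ) (hT : 0 ≤ T)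
    (hcross : a ^ 2 + g ^ 2 + b ^ 2 - 2 * (b / 100) * (4 * a + 2 * b + 6 * g + 4 * ρ) ≤ D ^ 2)
    (hmain : 1 / L / 8 * D ^ 2 ≤ lam * (κ * (a + b + 2 * g) + 3 / 2 * (κ * ρ) - T / 2)) :
    D ^ 2 ≤ 1024 * (L ^ 2 * lam ^ 2 * κ ^ 2 + L * lam * (κ * ρ)) := by
  -- The cross terms carry the small factor `b / 100`, so AM-GM absorbs them into the squares.
  have hS : a ^ 2 + b ^ 2 + g ^ 2 ≤ 2 * D ^ 2 + ρ ^ 2 := by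
    nlinarith [sq_nonneg (a - b), sq_nonneg (g - b), sq_nonneg (ρ - b), sq_nonneg a, sq_nonneg b,
      sq_nonneg g, sq_nonneg ρ]
  -- Cauchy–Schwarz with weights `(1, 1, 2)`: the square of the left side is at most `6(a² + b² +
  -- g²)`, and the three hinted squares are the exact defect.
  have hsum : a + b + 2 * g ≤ 4 * D + 3 * ρ := by
    refine le_of_sq_le_sq ?_ (by positivity)
    nlinarith [sq_nonneg (a - b), sq_nonneg (2 * a - g), sq_nonneg (2 * b - g), mul_nonneg hD hρ,
      sq_nonneg D, sq_nonneg ρ]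
  have hfin : 1 / L / 8 * D ^ 2 ≤ lam * (4 * κ * D + 9 / 2 * (κ * ρ)) := by
    refine hmain.trans (mul_le_mul_of_nonneg_left ?_ hlam.le)
    have := mul_le_mul_of_nonneg_left hsum hκ.le
    linarith
  rw [div_div, div_mul_eq_mul_div, one_mul, div_le_iff₀ (by positivity)] at hfin
  have hLR : 0 ≤ L * lam * (κ * ρ) := by positivity
  -- Here `D² ≤ 32LλκD + 36Lλκρ`; AM-GM on the linear term gives the constant `1024 = 32²`.
  nlinarith [sq_nonneg (D - 32 * L * lam * κ)]

theorem opNorm_sq_le_of_stableRank {M₀ κ : ℝ} {X : Matrix (Fin n) (Fin n) ℝ}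
    (h : X ≠ 0 → M₀ * κ ≤ stableRank X) : M₀ * κ * opNorm X ^ 2 ≤ frobNorm X ^ 2 := by
  by_cases hX : opNorm X = 0
  · rw [hX]; simpa using sq_nonneg (frobNorm X)
  · have h1 := h fun h0 => hX (by rw [h0, opNorm, map_zero, norm_zero])
    rwa [stableRank, le_div_iff₀ (by positivity)] at h1

/-- The threshold `10000 k` on the stable rank is used through its square root: the covariate part
of the error has operator norm at most `1 / (100√k)` times its Frobenius norm. -/
theorem deterministic_bound {k : ℕ} {M₁ M₂ lam : ℝ} {X A : Matrix (Fin n) (Fin n) ℝ}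
    {α αhat : Fin n → ℝ} {β βhat : ℝ} {G B Ghat : Matrix (Fin n) (Fin n) ℝ}
    (hn : 1 ≤ n) (hk : 1 ≤ k) (h0 : 0 ≤ M₂) (h1 : M₂ ≤ M₁)
    (hX : X ≠ 0 → 10000 * (k : ℝ) ≤ stableRank X)
    (hclass : InGeneralClass M₁ M₂ X α β G) (hB : IsBestRankApprox k G B)
    (hlam : 0 < lam)
    (hop : 2 * opNorm (A - probMatrix (logitMatrix X α β G)) ≤ lam)
    (hXE : |traceInner (A - probMatrix (logitMatrix X α β G)) ((frobNorm X)⁻¹ • X)| / √(k : ℝ)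
      ≤ lam)
    (hest : IsConvexEstimator A X M₁ M₂ lam αhat βhat Ghat) :
    frobNorm (logitMatrix X αhat βhat Ghat - logitMatrix X α β G) ^ 2 ≤
      1024 * (Real.exp (2 * M₁) * lam ^ 2 * k + Real.exp M₁ * lam * nuclearNorm (G - B)) := by
  obtain ⟨P, hP, hPk, hres⟩ := hB.exists_orthProj
  have hbasic := basic_inequality h0 h1 hclass.psd hclass.centered hclass.box hest
  obtain ⟨⟨hcGh, hGh, -⟩, -⟩ := hest
  have hcGh : Ghat * centering n = Ghat := hcGh
  have hGh : Ghat.PosSemidef := hGh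
  set E := A - probMatrix (logitMatrix X α β G)
  have hG := hclass.psd
  set κ := √(k : ℝ) with hκ
  have hκpos : 0 < κ := Real.sqrt_pos.2 (by exact_mod_cast hk)
  have hκsq : κ ^ 2 = k := Real.sq_sqrt (Nat.cast_nonneg k)
  have hPκ : frobNorm P ≤ κ := Real.le_sqrt_of_sq_le hPk
  rw [logitMatrix_sub] at hbasic ⊢
  set Δa := addMatrix (αhat - α)
  set Δb := (βhat - β) • X with hΔb
  set Δg := Ghat - G with hΔg
  set D := frobNorm (Δa + Δb + Δg)
  set a := frobNorm Δa
  set b := frobNorm Δb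
  set g := frobNorm Δg
  set R := nuclearNorm (G - B)
  have hD : 0 ≤ D := frobNorm_nonneg _
  have ha : 0 ≤ a := frobNorm_nonneg _
  have hb : 0 ≤ b := frobNorm_nonneg _
  have hg : 0 ≤ g := frobNorm_nonneg _
  have hR : 0 ≤ R := nuclearNorm_nonneg _
  set T := ((1 - P) * Ghat * (1 - P)).trace
  set r := ((1 - P) * G * (1 - P)).trace with hr
  have hT : 0 ≤ T := (PosSemidef.compress hP.compl.symm hGh).trace_nonneg
  have hrR : r ≤ R := by
    have := trace_le_nuclearNorm (G - B)
    have hrG : (G - B).trace = r := by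
      rw [hr, trace_mul_comm, ← Matrix.mul_assoc, hP.compl.idem, hres]
    rwa [hrG] at this
  have e1 : |traceInner E Δa| ≤ lam * a := (abs_traceInner_addMatrix_le E _).trans (by gcongr)
  have e2 : |traceInner E Δb| ≤ lam * κ * b := by
    by_cases hX0 : X = 0
    · have : traceInner E Δb = 0 := by rw [hΔb, hX0, smul_zero]; simp [traceInner]
      rw [this, abs_zero]; positivity
    · have hf : frobNorm X ≠ 0 := fun h => hX0 (frobNorm_eq_zero h)
      have hf' : 0 < frobNorm X := lt_of_le_of_ne (frobNorm_nonneg X) hf.symm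
      rw [div_le_iff₀ hκpos, traceInner_smul_right, abs_mul, abs_inv, abs_of_pos hf',
        inv_mul_le_iff₀ hf'] at hXE
      have hbe : b = |βhat - β| * frobNorm X := frobNorm_smul _ _
      rw [hΔb, traceInner_smul_right, abs_mul, hbe]
      nlinarith [mul_le_mul_of_nonneg_left hXE (abs_nonneg (βhat - β))]
  have e3 : |traceInner E Δg| ≤ lam / 2 * (2 * κ * g + T + r) := by
    refine (abs_traceInner_sub_le hP hPκ hG hGh E).trans ?_
    have hr0 : 0 ≤ r := (PosSemidef.compress hP.compl.symm hG).trace_nonneg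
    gcongr
    linarith
  have hr0 : 0 ≤ r := (PosSemidef.compress hP.compl.symm hG).trace_nonneg
  have e4 := trace_sub_le (G := G) (G' := Ghat) hP hPκ
  have hκ1 : 1 ≤ κ := by rw [hκ]; exact Real.one_le_sqrt.2 (by exact_mod_cast hk)
  -- Because `2‖E‖ ≤ λ`, the noise produces only `λT/2`, against the `-λT` supplied by the penalty;
  -- the net `-λT/2` survives.
  have hmain : Real.exp (-M₁) / 8 * D ^ 2 ≤ lam * (κ * (a + b + 2 * g) + 3 / 2 * R - T / 2) := by
    rw [traceInner_add_right, traceInner_add_right] at hbasic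
    have e4' := mul_le_mul_of_nonneg_left e4 hlam.le
    have e5 : lam * a ≤ lam * (κ * a) := by gcongr; nlinarith
    have e6 := mul_le_mul_of_nonneg_left hrR hlam.le
    linarith [le_abs_self (traceInner E Δa), le_abs_self (traceInner E Δb),
      le_abs_self (traceInner E Δg)]
  -- The cone condition: the left side of `hmain` is nonnegative, so the part of `Ĝ` outside the
  -- range of `P` is controlled by the rest.
  have hTle : T ≤ 2 * κ * (a + b + 2 * g) + 3 * R := by
    have := nonneg_of_mul_nonneg_right (le_trans (by positivity) hmain) hlam
    linarith
  have hopb : opNorm Δb ≤ b / (100 * κ) := by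
    have hopX : 100 * κ * opNorm X ≤ frobNorm X := by
      refine le_of_sq_le_sq ?_ (frobNorm_nonneg X)
      have := opNorm_sq_le_of_stableRank hX
      rw [← hκsq] at this
      linarith
    rw [le_div_iff₀ (by positivity), hΔb, opNorm_smul]
    have hbe : b = |βhat - β| * frobNorm X := frobNorm_smul _ _
    rw [hbe]
    nlinarith [mul_le_mul_of_nonneg_left hopX (abs_nonneg (βhat - β))]
  -- Rescaled so that `√k` factors out of every term, leaving inequalities free of `k`.
  set ρ := R / κ with hρ
  have hρ0 : 0 ≤ ρ := div_nonneg hR hκpos.le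
  have hRρ : R = κ * ρ := by rw [hρ]; field_simp
  have c1 : |traceInner Δb Δa| ≤ b / 100 * (2 * a) := by
    refine (abs_traceInner_addMatrix_le Δb _).trans ?_
    have : b / (100 * κ) ≤ b / 100 := by gcongr; linarith
    nlinarith [hopb.trans this]
  have c2 : |traceInner Δb Δg| ≤ b / 100 * (2 * a + 2 * b + 6 * g + 4 * ρ) := by
    refine (abs_traceInner_sub_le hP hPκ hG hGh Δb).trans ?_
    calc _ ≤ b / (100 * κ) * (κ * (2 * a + 2 * b + 6 * g + 4 * ρ)) := by
          gcongr
          linarith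
      _ = _ := by field_simp
  have c3 : traceInner Δa Δg = 0 := by
    have hcG := sum_col_eq_zero_of_centering_mul hn hclass.centered
    have hrG := sum_row_eq_zero_of_mul_centering hn ((centering_mul_iff hG).1 hclass.centered)
    have hcG' := sum_col_eq_zero_of_centering_mul hn ((centering_mul_iff hGh).2 hcGh)
    have hrG' := sum_row_eq_zero_of_mul_centering hn hcGh
    refine traceInner_addMatrix_eq_zero _ (fun i => ?_) fun j => ?_
    · simp [hΔg, Finset.sum_sub_distrib, hrG, hrG']
    · simp [hΔg, Finset.sum_sub_distrib, hcG, hcG']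
  have hDsq : D ^ 2 = a ^ 2 + 2 * traceInner Δb Δa + b ^ 2 + 2 * traceInner Δb Δg + g ^ 2 := by
    rw [frobNorm_add_sq, frobNorm_add_sq, traceInner_add_left, c3, traceInner_comm Δa Δb]
    ring
  have hL2 : Real.exp (2 * M₁) = Real.exp M₁ ^ 2 := by rw [← Real.exp_nat_mul]; norm_num
  rw [hL2, ← hκsq, hRρ]
  rw [hRρ] at hmain
  rw [Real.exp_neg, inv_eq_one_div] at hmain
  refine sq_le_of_basic_inequality hD hκpos hlam (Real.exp_pos M₁) hρ0 (T := T) hT ?_ hmain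
  nlinarith only [hDsq, abs_le.1 c1, abs_le.1 c2]

end LatentSpace

namespace LatentSpace

/-! ### Closed walks -/

section Walks

variable {V V' : Type*} {k : ℕ}

/-- The `t`-th edge of a walk. -/
def walkEdge (u : Fin (k + 1) → V) (t : Fin k) : Sym2 V := s(u t.castSucc, u t.succ)

/-- Closed walks without loops all of whose edges are traversed at least twice. -/
def IsDoubledWalk (u : Fin (k + 1) → V) : Prop :=
  u 0 = u (Fin.last k) ∧ (∀ t : Fin k, u t.castSucc ≠ u t.succ) ∧
    ∀ t : Fin k, ∃ s, s ≠ t ∧ walkEdge u s = walkEdge u t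

/-- Two walks have the same shape if they differ by a relabelling of the vertices. -/
def SameShape (u : Fin (k + 1) → V) (u' : Fin (k + 1) → V') : Prop :=
  ∀ a b, u a = u b ↔ u' a = u' b

theorem SameShape.isDoubledWalk_iff {u : Fin (k + 1) → V} {u' : Fin (k + 1) → V'}
    (h : SameShape u u') : IsDoubledWalk u ↔ IsDoubledWalk u' := by
  have h : ∀ a b, u a = u b ↔ u' a = u' b := h
  simp only [IsDoubledWalk, walkEdge, Sym2.eq_iff, ne_eq, h]

theorem SameShape.symm {u : Fin (k + 1) → V} {u' : Fin (k + 1) → V'} (h : SameShape u u') :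
    SameShape u' u := fun a b => (h a b).symm

theorem SameShape.card_image_le [DecidableEq V] [DecidableEq V'] {u : Fin (k + 1) → V}
    {u' : Fin (k + 1) → V'} (h : SameShape u u') :
    (Finset.univ.image u).card ≤ (Finset.univ.image u').card := by
  refine Finset.card_le_card_of_surjOn
    (fun w => if h : ∃ a, u' a = w then u h.choose else u 0) fun z hz => ?_
  obtain ⟨a, -, rfl⟩ := Finset.mem_image.1 (Finset.mem_coe.1 hz)
  refine ⟨u' a, by simp, ?_⟩
  have he : ∃ b, u' b = u' a := ⟨a, rfl⟩
  simp only [he, dif_pos]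
  exact (h _ _).2 he.choose_spec

theorem SameShape.card_image [DecidableEq V] [DecidableEq V'] {u : Fin (k + 1) → V}
    {u' : Fin (k + 1) → V'} (h : SameShape u u') :
    (Finset.univ.image u).card = (Finset.univ.image u').card :=
  le_antisymm h.card_image_le h.symm.card_image_le

/-- Labellings of a shape are the injections of its vertex set. -/
theorem card_sameShape [DecidableEq V] (u : Fin (k + 1) → V) (m : ℕ) :
    Nat.card {u' : Fin (k + 1) → Fin m // SameShape u u'} =
      m.descFactorial (Finset.univ.image u).card := by
  classical
  have e : {u' : Fin (k + 1) → Fin m // SameShape u u'} ≃ (Set.range u ↪ Fin m) :=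
    { toFun := fun u' => ⟨fun x => u'.1 x.2.choose, fun x y hxy => by
        have := (u'.2 _ _).2 hxy
        rw [x.2.choose_spec, y.2.choose_spec] at this
        exact Subtype.ext this⟩
      invFun := fun f => ⟨fun a => f ⟨u a, a, rfl⟩, fun a b => by
        exact ⟨fun h => congrArg f (Subtype.ext h),
          fun h => congrArg Subtype.val (f.injective h)⟩⟩
      left_inv := fun u' => by
        ext1
        funext a
        have h : ∃ b, u b = u a := ⟨a, rfl⟩
        exact (u'.2 _ _).1 h.choose_spec
      right_inv := fun f => by
        ext x : 1
        exact congrArg f (Subtype.ext x.2.choose_spec) }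
  have : Fintype.card (Set.range u) = (Finset.univ.image u).card := by
    rw [← Set.toFinset_card, Set.toFinset_range]
  rw [Nat.card_congr e, Nat.card_eq_fintype_card, Fintype.card_embedding_eq, this,
    Fintype.card_fin]

theorem walkEdge_mem {u : Fin (k + 1) → V} {t : Fin k} {v : V} (h : v ∈ walkEdge u t) :
    ∃ a, u a = v := by
  rcases Sym2.mem_iff.1 h with h | h
  exacts [⟨_, h.symm⟩, ⟨_, h.symm⟩]

/-- A walk visits at most one vertex more than it has edges. -/
theorem card_image_le_card_walkEdge [DecidableEq V] (u : Fin (k + 1) → V) :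
    (Finset.univ.image u).card ≤ (Finset.univ.image (walkEdge u)).card + 1 := by
  induction k with
  | zero => exact Finset.card_image_le.trans (by simp)
  | succ k ih =>
    set u' : Fin (k + 1) → V := fun a => u a.succ
    have hv : Finset.univ.image u = insert (u 0) (Finset.univ.image u') := by
      ext v
      simp [Fin.exists_fin_succ, u', eq_comm]
    have he : Finset.univ.image (walkEdge u) =
        insert s(u 0, u 1) (Finset.univ.image (walkEdge u')) := by
      ext v
      simp [Fin.exists_fin_succ, u', walkEdge, eq_comm]
    have hi := ih u'
    rw [hv, he]
    by_cases h : u 0 ∈ Finset.univ.image u'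
    · rw [Finset.insert_eq_of_mem h]
      exact hi.trans (by gcongr; exact Finset.subset_insert _ _)
    · rw [Finset.card_insert_of_notMem h, Finset.card_insert_of_notMem]
      · omega
      · intro h'
        obtain ⟨t, -, ht⟩ := Finset.mem_image.1 h'
        obtain ⟨a, ha⟩ := walkEdge_mem (u := u') (t := t) (v := u 0) (by rw [ht]; simp)
        exact h (Finset.mem_image.2 ⟨a, Finset.mem_univ _, ha⟩)

/-- The fibres of the edge map have at least two elements. With `card_image_le_card_walkEdge`, a
doubled walk of length `2q` visits at most `q + 1` vertices. -/
theorem IsDoubledWalk.two_mul_card_le [DecidableEq V] {u : Fin (k + 1) → V}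
    (h : IsDoubledWalk u) : 2 * (Finset.univ.image (walkEdge u)).card ≤ k := by
  have := Finset.mul_card_image_le_card (f := walkEdge u) (s := Finset.univ) 2 (fun x hx => by
    obtain ⟨t, -, rfl⟩ := Finset.mem_image.1 hx
    obtain ⟨s, hs, hst⟩ := h.2.2 t
    rw [← Finset.card_pair hs]
    refine Finset.card_le_card fun r hr => ?_
    rcases Finset.mem_insert.1 hr with rfl | hr
    · simp [hst]
    · rw [Finset.mem_singleton.1 hr]; simp)
  simpa using this

/-- With `w = v - 1 ≤ q`, the numerator is at most `n (np)^w ≤ n q^w`. The denominator is `2q` times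
`w` factors, the smallest being `2q - w ≥ q`. -/
theorem descFactorial_weight_le {n q v : ℕ} {p : ℝ} (hp : 0 ≤ p) (hnp : n * p ≤ q) (hv : 1 ≤ v)
    (hvq : v ≤ q + 1) (hq : 1 ≤ q) :
    (n.descFactorial v : ℝ) * p ^ (v - 1) / ((2 * q).descFactorial v : ℝ) ≤ n / (2 * q : ℕ) := by
  obtain ⟨w, rfl⟩ : ∃ w, v = w + 1 := ⟨v - 1, by omega⟩
  obtain ⟨m, hm⟩ : ∃ m, 2 * q = m + 1 := ⟨2 * q - 1, by omega⟩
  rw [hm, Nat.succ_descFactorial_succ, Nat.add_sub_cancel]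
  have h1 : ((n.descFactorial (w + 1) : ℕ) : ℝ) ≤ n * n ^ w := by
    rw [← pow_succ']; exact_mod_cast Nat.descFactorial_le_pow n (w + 1)
  have h2 : (q : ℝ) ^ w ≤ (m.descFactorial w : ℕ) := by
    have := (Nat.pow_le_pow_left (show q ≤ m + 1 - w by omega) w).trans
      (Nat.pow_sub_le_descFactorial m w)
    exact_mod_cast this
  have hq' : (0 : ℝ) < q := by exact_mod_cast hq
  have h3 : (0 : ℝ) < (m.descFactorial w : ℕ) := lt_of_lt_of_le (by positivity) h2
  rw [Nat.cast_mul, div_le_div_iff₀ (by positivity) (by positivity)]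
  have h4 : (n * p) ^ w ≤ (m.descFactorial w : ℕ) :=
    (pow_le_pow_left₀ (by positivity) hnp w).trans h2
  calc (n.descFactorial (w + 1) : ℝ) * p ^ w * ((m + 1 : ℕ) : ℝ)
      ≤ (n * n ^ w) * p ^ w * ((m + 1 : ℕ) : ℝ) := by gcongr
    _ = n * ((m + 1 : ℕ) : ℝ) * (n * p) ^ w := by rw [mul_pow]; ring
    _ ≤ n * ((m + 1 : ℕ) : ℝ) * (m.descFactorial w : ℕ) := by gcongr
    _ = _ := by ring

open Classical in
/-- Doubled walks on `n` vertices, weighted for sparsity, are dominated by doubled walks on a small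
complete graph. -/
theorem sum_doubledWalk_le {n q : ℕ} {p : ℝ} (hp : 0 ≤ p) (hnp : n * p ≤ q) (hq : 1 ≤ q) :
    ∑ u : Fin (2 * q + 1) → Fin n,
        (if IsDoubledWalk u then p ^ ((Finset.univ.image u).card - 1) else 0) ≤
      n / (2 * q : ℕ) *
        ∑ u : Fin (2 * q + 1) → Fin (2 * q), if IsDoubledWalk u then (1 : ℝ) else 0 := by
  set v : ∀ {r : ℕ}, (Fin (2 * q + 1) → Fin r) → ℕ := fun u => (Finset.univ.image u).card
  have hv1 : ∀ {r : ℕ} (u : Fin (2 * q + 1) → Fin r), 1 ≤ v u := fun u =>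
    Finset.card_pos.2 (by simp)
  have hvq : ∀ {r : ℕ} (u : Fin (2 * q + 1) → Fin r), IsDoubledWalk u → v u ≤ q + 1 :=
    fun u hu => by
      have h1 := card_image_le_card_walkEdge u
      have h2 := hu.two_mul_card_le
      have : v u = (Finset.univ.image u).card := rfl
      omega
  have hcount : ∀ {r : ℕ} (u : Fin (2 * q + 1) → Fin r) (m : ℕ),
      ∑ u' : Fin (2 * q + 1) → Fin m, (if SameShape u u' then (1 : ℝ) else 0) =
        m.descFactorial (v u) := fun u m => by
    rw [Finset.sum_boole, ← card_sameShape, Nat.card_eq_fintype_card, Fintype.card_subtype]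
  -- Double counting: each walk on `n` vertices is spread evenly over the walks of the same shape on
  -- `2q` vertices, and the sums are exchanged. Such walks exist because `v ≤ q + 1 ≤ 2q`.
  calc ∑ u : Fin (2 * q + 1) → Fin n, (if IsDoubledWalk u then p ^ (v u - 1) else 0)
      = ∑ u : Fin (2 * q + 1) → Fin n, ∑ u' : Fin (2 * q + 1) → Fin (2 * q),
          (if IsDoubledWalk u then p ^ (v u - 1) / ((2 * q).descFactorial (v u) : ℝ) else 0) *
            (if SameShape u u' then 1 else 0) := by
        refine Finset.sum_congr rfl fun u _ => ?_
        rw [← Finset.mul_sum, hcount]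
        split_ifs with hu
        · have : ((2 * q).descFactorial (v u) : ℝ) ≠ 0 := by
            rw [Nat.cast_ne_zero, Ne, Nat.descFactorial_eq_zero_iff_lt]
            have := hvq u hu
            omega
          field_simp
        · simp
    _ = ∑ u' : Fin (2 * q + 1) → Fin (2 * q), ∑ u : Fin (2 * q + 1) → Fin n,
          (if IsDoubledWalk u' then p ^ (v u' - 1) / ((2 * q).descFactorial (v u') : ℝ) else 0) *
            (if SameShape u' u then 1 else 0) := by
        rw [Finset.sum_comm]
        refine Finset.sum_congr rfl fun u' _ => Finset.sum_congr rfl fun u _ => ?_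
        by_cases h : SameShape u u'
        · have h' : SameShape u' u := fun a b => (h a b).symm
          have hvv : v u = v u' := h.card_image
          simp only [h, h', h.isDoubledWalk_iff, hvv]
        · have h' : ¬SameShape u' u := fun h'' => h h''.symm
          simp [h, h']
    _ ≤ ∑ u' : Fin (2 * q + 1) → Fin (2 * q),
          n / (2 * q : ℕ) * (if IsDoubledWalk u' then (1 : ℝ) else 0) := by
        refine Finset.sum_le_sum fun u' _ => ?_
        rw [← Finset.mul_sum, hcount]
        split_ifs with hu
        · rw [mul_one]
          refine le_trans (le_of_eq ?_) (descFactorial_weight_le hp hnp (hv1 u') (hvq u' hu) hq)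
          ring
        · simp
    _ = _ := by rw [Finset.mul_sum]

end Walks

/-! ### Powers of a matrix as sums over walks -/

theorem matrix_pow_apply_eq_sum_walk {n : ℕ} (M : Matrix (Fin n) (Fin n) ℝ) (k : ℕ)
    (i j : Fin n) :
    (M ^ k) i j = ∑ u : Fin (k + 1) → Fin n, if u 0 = i ∧ u (Fin.last k) = j then
      ∏ t : Fin k, M (u t.castSucc) (u t.succ) else 0 := by
  induction k generalizing i with
  | zero =>
    rw [pow_zero, Matrix.one_apply,
      ← (Equiv.funUnique (Fin 1) (Fin n)).symm.sum_comp]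
    simp only [Finset.univ_eq_empty, Finset.prod_empty]
    by_cases h : i = j
    · subst h
      simp
    · rw [if_neg h]
      refine (Finset.sum_eq_zero fun x _ => if_neg ?_).symm
      rintro ⟨h1, h2⟩
      exact h (h1.symm.trans h2)
  | succ k ih =>
    rw [pow_succ', Matrix.mul_apply, ← (Fin.consEquiv fun _ => Fin n).sum_comp,
      Fintype.sum_prod_type]
    refine Eq.trans ?_ (Finset.sum_eq_single i ?_ ?_).symm
    · simp only [ih, Finset.mul_sum]
      rw [Finset.sum_comm]
      refine Finset.sum_congr rfl fun u _ => ?_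
      rw [Finset.sum_eq_single (u 0)]
      · simp [Fin.consEquiv, Fin.prod_univ_succ, ← Fin.succ_last]
      · intro b _ hb
        simp [hb.symm]
      · simp
    · intro b _ hb
      simp [Fin.consEquiv, hb]
    · simp

theorem trace_pow_eq_sum_walk {n : ℕ} (M : Matrix (Fin n) (Fin n) ℝ) (k : ℕ) :
    (M ^ k).trace = ∑ u : Fin (k + 1) → Fin n, if u 0 = u (Fin.last k) then
      ∏ t : Fin k, M (u t.castSucc) (u t.succ) else 0 := by
  simp only [Matrix.trace, Matrix.diag_apply, matrix_pow_apply_eq_sum_walk]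
  rw [Finset.sum_comm]
  refine Finset.sum_congr rfl fun u _ => ?_
  rw [Finset.sum_eq_single (u 0)]
  · simp [eq_comm]
  · intro b _ hb
    simp [hb.symm]
  · simp

end LatentSpace

namespace LatentSpace

open Matrix

variable {n : ℕ}

/-! ### Symmetric random matrices with independent entries above the diagonal -/

/-- The pairs `i < j`. -/
abbrev EdgeIndex (n : ℕ) := {e : Fin n × Fin n // e.1 < e.2}

/-- The symmetric matrix with zero diagonal and prescribed entries above the diagonal. -/
def edgeMatrix (w : EdgeIndex n → ℝ) : Matrix (Fin n) (Fin n) ℝ :=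
  Matrix.of fun i j => if h : i < j then w ⟨(i, j), h⟩ else if h : j < i then w ⟨(j, i), h⟩ else 0

theorem edgeMatrix_self (w : EdgeIndex n → ℝ) (i : Fin n) : edgeMatrix w i i = 0 := by
  simp [edgeMatrix]

theorem edgeMatrix_of_lt (w : EdgeIndex n → ℝ) {i j : Fin n} (h : i < j) :
    edgeMatrix w i j = w ⟨(i, j), h⟩ := by
  simp [edgeMatrix, h]

theorem edgeMatrix_of_gt (w : EdgeIndex n → ℝ) {i j : Fin n} (h : j < i) :
    edgeMatrix w i j = w ⟨(j, i), h⟩ := by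
  simp [edgeMatrix, h, h.not_gt]

theorem edgeMatrix_transpose (w : EdgeIndex n → ℝ) : (edgeMatrix w)ᵀ = edgeMatrix w := by
  ext i j
  rw [transpose_apply]
  rcases lt_trichotomy i j with h | rfl | h
  · rw [edgeMatrix_of_lt w h, edgeMatrix_of_gt w h]
  · rfl
  · rw [edgeMatrix_of_lt w h, edgeMatrix_of_gt w h]

/-- Writing an entry as a product over all edges lets the product along a walk be regrouped into
powers of independent variables. -/
theorem edgeMatrix_apply_eq_prod (w : EdgeIndex n → ℝ) {i j : Fin n} (hij : i ≠ j) :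
    edgeMatrix w i j = ∏ e : EdgeIndex n, if s(i, j) = s(e.1.1, e.1.2) then w e else 1 := by
  have key : ∀ {a b : Fin n} (hab : a < b),
      ∏ e : EdgeIndex n, (if s(a, b) = s(e.1.1, e.1.2) then w e else 1) = w ⟨(a, b), hab⟩ := by
    intro a b hab
    rw [Finset.prod_eq_single ⟨(a, b), hab⟩]
    · simp
    · rintro ⟨⟨c, d⟩, hcd⟩ - hne
      refine if_neg fun h => ?_
      rcases Sym2.eq_iff.1 h with ⟨rfl, rfl⟩ | ⟨rfl, rfl⟩
      · exact hne rfl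
      · exact absurd hab hcd.not_gt
    · simp
  rcases lt_or_gt_of_ne hij with h | h
  · rw [key h, edgeMatrix_of_lt w h]
  · rw [Sym2.eq_swap, key h, edgeMatrix_of_gt w h]

/-- How often a walk uses an edge. -/
def edgeCount {k : ℕ} (u : Fin (k + 1) → Fin n) (e : EdgeIndex n) : ℕ :=
  (Finset.univ.filter fun t => walkEdge u t = s(e.1.1, e.1.2)).card

theorem prod_edgeMatrix_eq {k : ℕ} (w : EdgeIndex n → ℝ) {u : Fin (k + 1) → Fin n}
    (hu : ∀ t : Fin k, u t.castSucc ≠ u t.succ) :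
    ∏ t : Fin k, edgeMatrix w (u t.castSucc) (u t.succ) = ∏ e, w e ^ edgeCount u e := by
  rw [Finset.prod_congr rfl fun t _ => edgeMatrix_apply_eq_prod w (hu t), Finset.prod_comm]
  refine Finset.prod_congr rfl fun e _ => ?_
  rw [Finset.prod_ite, Finset.prod_const, Finset.prod_const_one, mul_one]
  rfl

theorem prod_edgeMatrix_eq_zero {k : ℕ} (w : EdgeIndex n → ℝ) {u : Fin (k + 1) → Fin n}
    (hu : ¬∀ t : Fin k, u t.castSucc ≠ u t.succ) :
    ∏ t : Fin k, edgeMatrix w (u t.castSucc) (u t.succ) = 0 := by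
  push Not at hu
  obtain ⟨t, ht⟩ := hu
  exact Finset.prod_eq_zero (Finset.mem_univ t) (by rw [ht, edgeMatrix_self])

theorem exists_edgeIndex {k : ℕ} {u : Fin (k + 1) → Fin n} (t : Fin k)
    (hu : u t.castSucc ≠ u t.succ) :
    ∃ e : EdgeIndex n, walkEdge u t = s(e.1.1, e.1.2) := by
  rcases lt_or_gt_of_ne hu with h | h
  · exact ⟨⟨(_, _), h⟩, rfl⟩
  · exact ⟨⟨(_, _), h⟩, Sym2.eq_swap⟩

theorem exists_edgeCount_eq_one {k : ℕ} {u : Fin (k + 1) → Fin n}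
    (hc : u 0 = u (Fin.last k)) (hu : ∀ t : Fin k, u t.castSucc ≠ u t.succ)
    (hd : ¬IsDoubledWalk u) : ∃ e, edgeCount u e = 1 := by
  have h : ∃ t : Fin k, ∀ s, s ≠ t → walkEdge u s ≠ walkEdge u t := by
    by_contra! h
    exact hd ⟨hc, hu, h⟩
  obtain ⟨t, ht⟩ := h
  obtain ⟨e, he⟩ := exists_edgeIndex t (hu t)
  refine ⟨e, ?_⟩
  rw [edgeCount, Finset.card_eq_one]
  refine ⟨t, ?_⟩
  ext s
  rw [Finset.mem_filter, ← he, Finset.mem_singleton]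
  refine ⟨fun hs => ?_, fun hs => ⟨Finset.mem_univ _, by rw [hs]⟩⟩
  by_contra hne
  exact ht s hne hs.2

theorem IsDoubledWalk.two_le_edgeCount {k : ℕ} {u : Fin (k + 1) → Fin n} (hu : IsDoubledWalk u)
    {e : EdgeIndex n} (he : edgeCount u e ≠ 0) : 2 ≤ edgeCount u e := by
  obtain ⟨t, ht⟩ := Finset.card_ne_zero.1 he
  rw [Finset.mem_filter] at ht
  obtain ⟨s, hs, hst⟩ := hu.2.2 t
  refine Finset.one_lt_card.2 ⟨s, ?_, t, ?_, hs⟩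
  · simp [hst, ht.2]
  · simp [ht.2]

theorem card_image_le_card_edgeCount_support {k : ℕ} {u : Fin (k + 1) → Fin n}
    (hu : ∀ t : Fin k, u t.castSucc ≠ u t.succ) :
    (Finset.univ.image u).card - 1 ≤ (Finset.univ.filter fun e => edgeCount u e ≠ 0).card := by
  have h1 := card_image_le_card_walkEdge u
  have h2 : Finset.univ.image (walkEdge u) ⊆
      (Finset.univ.filter fun e => edgeCount u e ≠ 0).image fun e => s(e.1.1, e.1.2) := by
    intro z hz
    obtain ⟨t, -, rfl⟩ := Finset.mem_image.1 hz
    obtain ⟨e, he⟩ := exists_edgeIndex t (hu t)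
    refine Finset.mem_image.2 ⟨e, Finset.mem_filter.2 ⟨Finset.mem_univ _, ?_⟩, he.symm⟩
    exact Finset.card_ne_zero.2 ⟨t, by simp [he]⟩
  have h3 := (Finset.card_le_card h2).trans Finset.card_image_le
  omega

/-! ### Expected traces of powers: which closed walks survive -/

section Moments

variable {Ω : Type*} [MeasurableSpace Ω] {μ : Measure Ω} {W : EdgeIndex n → Ω → ℝ} {b : ℝ}

theorem abs_edgeMatrix_le {Ω : Type*} {W : EdgeIndex n → Ω → ℝ} {b : ℝ} (hb : ∀ e ω, |W e ω| ≤ b) (hb0 : 0 ≤ b) (ω : Ω) (i j : Fin n) :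
    |edgeMatrix (fun e => W e ω) i j| ≤ b := by
  rcases lt_trichotomy i j with h | rfl | h
  · rw [edgeMatrix_of_lt _ h]; exact hb _ _
  · rw [edgeMatrix_self, abs_zero]; exact hb0
  · rw [edgeMatrix_of_gt _ h]; exact hb _ _

theorem measurable_edgeMatrix (hm : ∀ e, Measurable (W e)) (i j : Fin n) :
    Measurable fun ω => edgeMatrix (fun e => W e ω) i j := by
  rcases lt_trichotomy i j with h | rfl | h
  · simp only [edgeMatrix_of_lt _ h]; exact hm _
  · simp only [edgeMatrix_self]; exact measurable_const
  · simp only [edgeMatrix_of_gt _ h]; exact hm _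

theorem integrable_prod_edgeMatrix [IsProbabilityMeasure μ] (hm : ∀ e, Measurable (W e))
    (hb : ∀ e ω, |W e ω| ≤ b) (hb0 : 0 ≤ b) {k : ℕ} (u : Fin (k + 1) → Fin n) :
    Integrable (fun ω => ∏ t : Fin k, edgeMatrix (fun e => W e ω) (u t.castSucc) (u t.succ)) μ := by
  refine Integrable.of_bound (C := b ^ k) ?_ (ae_of_all _ fun ω => ?_)
  · exact (Finset.measurable_prod _ fun t _ => measurable_edgeMatrix hm _ _).aestronglyMeasurable
  · rw [Real.norm_eq_abs, Finset.abs_prod]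
    refine (Finset.prod_le_prod (fun _ _ => abs_nonneg _) fun t _ =>
      abs_edgeMatrix_le hb hb0 ω _ _).trans ?_
    simp

theorem integral_prod_edgeMatrix (hi : iIndepFun W μ) (hm : ∀ e, Measurable (W e)) {k : ℕ}
    {u : Fin (k + 1) → Fin n} (hu : ∀ t : Fin k, u t.castSucc ≠ u t.succ) :
    ∫ ω, ∏ t : Fin k, edgeMatrix (fun e => W e ω) (u t.castSucc) (u t.succ) ∂μ =
      ∏ e, ∫ ω, W e ω ^ edgeCount u e ∂μ := by
  simp only [prod_edgeMatrix_eq _ hu]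
  exact hi.integral_fun_prod_comp (f := fun e x => x ^ edgeCount u e)
    (fun e => (hm e).aemeasurable) fun e => (measurable_id.pow_const _).aestronglyMeasurable

theorem integral_trace_pow [IsProbabilityMeasure μ] (hm : ∀ e, Measurable (W e))
    (hb : ∀ e ω, |W e ω| ≤ b) (hb0 : 0 ≤ b) (k : ℕ) :
    ∫ ω, (edgeMatrix (fun e => W e ω) ^ k).trace ∂μ = ∑ u : Fin (k + 1) → Fin n,
      if u 0 = u (Fin.last k) then
        ∫ ω, ∏ t : Fin k, edgeMatrix (fun e => W e ω) (u t.castSucc) (u t.succ) ∂μ else 0 := by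
  simp only [trace_pow_eq_sum_walk]
  rw [integral_finsetSum]
  · refine Finset.sum_congr rfl fun u _ => ?_
    split_ifs
    · rfl
    · simp
  · intro u _
    split_ifs
    · exact integrable_prod_edgeMatrix hm hb hb0 u
    · exact integrable_zero _ _ _

theorem integrable_trace_pow [IsProbabilityMeasure μ] (hm : ∀ e, Measurable (W e))
    (hb : ∀ e ω, |W e ω| ≤ b) (hb0 : 0 ≤ b) (k : ℕ) :
    Integrable (fun ω => (edgeMatrix (fun e => W e ω) ^ k).trace) μ := by
  simp only [trace_pow_eq_sum_walk]
  refine integrable_finsetSum _ fun u _ => ?_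
  split_ifs
  · exact integrable_prod_edgeMatrix hm hb hb0 u
  · exact integrable_zero _ _ _

open Classical in
-- Independence factors the expectation over edges. A closed loopless walk that is not doubled has
-- an edge used once, whose mean is zero. A doubled walk contributes at most `p` per distinct edge,
-- and it has at least one fewer edge than vertices; `p ≤ 1` allows the exponent to be lowered.
theorem integral_trace_pow_le [IsProbabilityMeasure μ] (hi : iIndepFun W μ)
    (hm : ∀ e, Measurable (W e)) (hb : ∀ e ω, |W e ω| ≤ b) (hb0 : 0 ≤ b) {p : ℝ} (hp0 : 0 ≤ p)
    (hp1 : p ≤ 1) (hmean : ∀ e, ∫ ω, W e ω ∂μ = 0)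
    (hmom : ∀ e r, 2 ≤ r → |∫ ω, W e ω ^ r ∂μ| ≤ p) (k : ℕ) :
    ∫ ω, (edgeMatrix (fun e => W e ω) ^ k).trace ∂μ ≤ ∑ u : Fin (k + 1) → Fin n,
      if IsDoubledWalk u then p ^ ((Finset.univ.image u).card - 1) else 0 := by
  rw [integral_trace_pow hm hb hb0]
  refine Finset.sum_le_sum fun u _ => ?_
  by_cases hc : u 0 = u (Fin.last k)
  swap
  · rw [if_neg hc]
    split_ifs <;> positivity
  rw [if_pos hc]
  by_cases hu : ∀ t : Fin k, u t.castSucc ≠ u t.succ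
  swap
  · simp only [prod_edgeMatrix_eq_zero _ hu, integral_zero]
    split_ifs <;> positivity
  rw [integral_prod_edgeMatrix hi hm hu]
  by_cases hd : IsDoubledWalk u
  · rw [if_pos hd]
    refine (le_abs_self _).trans ?_
    rw [Finset.abs_prod]
    calc ∏ e, |∫ ω, W e ω ^ edgeCount u e ∂μ|
        ≤ ∏ e, (if edgeCount u e ≠ 0 then p else 1) := by
          refine Finset.prod_le_prod (fun _ _ => abs_nonneg _) fun e _ => ?_
          split_ifs with h
          · exact hmom e _ (hd.two_le_edgeCount h)
          · simp [not_not.1 h]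
      _ = p ^ (Finset.univ.filter fun e => edgeCount u e ≠ 0).card := by
          rw [Finset.prod_ite, Finset.prod_const, Finset.prod_const_one, mul_one]
      _ ≤ _ := pow_le_pow_of_le_one hp0 hp1 (card_image_le_card_edgeCount_support hu)
  · rw [if_neg hd]
    obtain ⟨e, he⟩ := exists_edgeCount_eq_one hc hu hd
    refine le_of_eq (Finset.prod_eq_zero (Finset.mem_univ e) ?_)
    simp [he, hmean]

open Classical in
-- The converse estimate: moments at least one make every doubled walk contribute at least one,
-- while the others still vanish. It turns the counting of walks into a question about a random
-- matrix.
theorem le_integral_trace_pow [IsProbabilityMeasure μ] (hi : iIndepFun W μ)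
    (hm : ∀ e, Measurable (W e)) (hb : ∀ e ω, |W e ω| ≤ b) (hb0 : 0 ≤ b)
    (hmean : ∀ e, ∫ ω, W e ω ∂μ = 0) (hmom : ∀ e r, 2 ≤ r → 1 ≤ ∫ ω, W e ω ^ r ∂μ) (k : ℕ) :
    ∑ u : Fin (k + 1) → Fin n, (if IsDoubledWalk u then (1 : ℝ) else 0) ≤
      ∫ ω, (edgeMatrix (fun e => W e ω) ^ k).trace ∂μ := by
  rw [integral_trace_pow hm hb hb0]
  refine Finset.sum_le_sum fun u _ => ?_
  by_cases hd : IsDoubledWalk u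
  · rw [if_pos hd, if_pos hd.1, integral_prod_edgeMatrix hi hm hd.2.1]
    rw [← Finset.prod_const_one (s := (Finset.univ : Finset (EdgeIndex n)))]
    refine Finset.prod_le_prod (fun _ _ => zero_le_one) fun e _ => ?_
    by_cases h : edgeCount u e = 0
    · simp [h]
    · exact hmom e _ (hd.two_le_edgeCount h)
  rw [if_neg hd]
  by_cases hc : u 0 = u (Fin.last k)
  swap
  · rw [if_neg hc]
  rw [if_pos hc]
  by_cases hu : ∀ t : Fin k, u t.castSucc ≠ u t.succ
  · rw [integral_prod_edgeMatrix hi hm hu]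
    obtain ⟨e, he⟩ := exists_edgeCount_eq_one hc hu hd
    refine (Finset.prod_eq_zero (Finset.mem_univ e) ?_).ge
    simp [he, hmean]
  · simp only [prod_edgeMatrix_eq_zero _ hu, integral_zero]
    exact le_rfl

/-- Weighted sums of bounded centered independent variables are sub-Gaussian. -/
theorem exists_hasSubgaussianMGF_sum [IsProbabilityMeasure μ] (hi : iIndepFun W μ)
    (hm : ∀ e, Measurable (W e)) (hmean : ∀ e, ∫ ω, W e ω ∂μ = 0) {lo hi' : EdgeIndex n → ℝ}
    (hW : ∀ e ω, W e ω ∈ Set.Icc (lo e) (hi' e)) {r : ℝ} (hr : ∀ e, hi' e - lo e = r)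
    (a : EdgeIndex n → ℝ) :
    ∃ c : NNReal, (c : ℝ) = (r / 2) ^ 2 * ∑ e, a e ^ 2 ∧
      HasSubgaussianMGF (fun ω => ∑ e, a e * W e ω) c μ := by
  have h1 : ∀ e, HasSubgaussianMGF (fun ω => a e * W e ω)
      (⟨a e ^ 2, sq_nonneg _⟩ * (‖hi' e - lo e‖₊ / 2) ^ 2) μ := fun e =>
    (hasSubgaussianMGF_of_mem_Icc_of_integral_eq_zero (hm e).aemeasurable
      (ae_of_all _ (hW e)) (hmean e)).const_mul (a e)
  have h2 : iIndepFun (fun e ω => a e * W e ω) μ :=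
    hi.comp (fun e x => a e * x) fun e => measurable_const_mul (a e)
  refine ⟨_, ?_, HasSubgaussianMGF.sum_of_iIndepFun h2 fun e _ => h1 e⟩
  push_cast
  rw [Finset.mul_sum]
  refine Finset.sum_congr rfl fun e _ => ?_
  rw [← hr e]
  change a e ^ 2 * (‖hi' e - lo e‖ / 2) ^ 2 = _
  rw [Real.norm_eq_abs, div_pow, sq_abs, ← div_pow, mul_comm]

end Moments

/-! ### Operator norms, traces of powers and nets -/

/-- Iterating the C*-identity `‖T²‖ = ‖T‖²` gives only powers of two, which is why the moment order
is taken to be `2 * 2 ^ j` below. -/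
theorem opNorm_pow_two_pow {M : Matrix (Fin n) (Fin n) ℝ} (hM : Mᵀ = M) (j : ℕ) :
    opNorm (M ^ 2 ^ j) = opNorm M ^ 2 ^ j := by
  have h : IsSelfAdjoint (toEuclideanCLM (𝕜 := ℝ) M) := by
    rw [IsSelfAdjoint, ← map_star, star_eq_conjTranspose, conjTranspose_eq_transpose_of_trivial, hM]
  rw [opNorm, map_pow, h.norm_pow_two_pow, opNorm]

theorem frobNorm_pow_sq {M : Matrix (Fin n) (Fin n) ℝ} (hM : Mᵀ = M) (q : ℕ) :
    frobNorm (M ^ q) ^ 2 = (M ^ (2 * q)).trace := by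
  rw [← traceInner_self, traceInner, transpose_pow, hM, ← pow_add, two_mul]

/-- For symmetric `M`, `Tr M^{2q} = ‖M^q‖_F²` lies between `‖M^q‖²` and `n‖M^q‖²`. -/
theorem opNorm_pow_le_trace {M : Matrix (Fin n) (Fin n) ℝ} (hM : Mᵀ = M) (j : ℕ) :
    opNorm M ^ (2 * 2 ^ j) ≤ (M ^ (2 * 2 ^ j)).trace := by
  rw [← frobNorm_pow_sq hM, mul_comm, pow_mul, ← opNorm_pow_two_pow hM]
  exact pow_le_pow_left₀ (opNorm_nonneg _) (opNorm_le_frobNorm _) 2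

theorem trace_pow_le_opNorm_pow {M : Matrix (Fin n) (Fin n) ℝ} (hM : Mᵀ = M) (j : ℕ) :
    (M ^ (2 * 2 ^ j)).trace ≤ n * opNorm M ^ (2 * 2 ^ j) := by
  rw [← frobNorm_pow_sq hM, mul_comm 2, pow_mul (opNorm M), ← opNorm_pow_two_pow hM]
  exact frobNorm_sq_le_opNorm_sq _

/-- A 1-separated subset of the ball of radius 2 has at most `5^n` points, so one of maximal
cardinality exists, and maximality makes it a net. -/
theorem exists_net (n : ℕ) : ∃ N : Finset (EuclideanSpace ℝ (Fin n)), N.card ≤ 5 ^ n ∧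
    (∀ x ∈ N, ‖x‖ ≤ 2) ∧ ∀ z : EuclideanSpace ℝ (Fin n), ‖z‖ ≤ 2 → ∃ x ∈ N, ‖z - x‖ ≤ 1 := by
  classical
  set good : Finset (EuclideanSpace ℝ (Fin n)) → Prop := fun s =>
    (∀ c ∈ s, ‖c‖ ≤ 2) ∧ ∀ c ∈ s, ∀ d ∈ s, c ≠ d → 1 ≤ ‖c - d‖ with hgood
  have hcard : ∀ s, good s → s.card ≤ 5 ^ n := fun s hs => by
    simpa using Besicovitch.card_le_of_separated s hs.1 hs.2
  set r := Nat.findGreatest (fun r => ∃ s, good s ∧ s.card = r) (5 ^ n) with hr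
  obtain ⟨N, hN, hNr⟩ : ∃ s, good s ∧ s.card = r :=
    Nat.findGreatest_spec (P := fun r => ∃ s, good s ∧ s.card = r) (Nat.zero_le (5 ^ n))
      ⟨∅, by simp [hgood], rfl⟩
  refine ⟨N, hcard N hN, hN.1, fun z hz => ?_⟩
  by_contra! hcon
  have hzN : z ∉ N := fun h => by have := hcon z h; simp at this; linarith
  have hins : good (insert z N) := by
    refine ⟨fun c hc => ?_, fun c hc d hd hcd => ?_⟩
    · rcases Finset.mem_insert.1 hc with rfl | hc
      exacts [hz, hN.1 c hc]
    · rcases Finset.mem_insert.1 hc with rfl | hc' <;> rcases Finset.mem_insert.1 hd with rfl | hd'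
      · exact absurd rfl hcd
      · exact (hcon d hd').le
      · rw [norm_sub_rev]; exact (hcon c hc').le
      · exact hN.2 c hc' d hd' hcd
  have h1 := Nat.le_findGreatest (P := fun r => ∃ s, good s ∧ s.card = r) (hcard _ hins)
    ⟨_, hins, rfl⟩
  rw [← hr, Finset.card_insert_of_notMem hzN] at h1
  omega

/-- A bilinear form is almost maximal on a net. -/
theorem exists_opNorm_le_of_net {N : Finset (EuclideanSpace ℝ (Fin n))}
    (hN : ∀ z : EuclideanSpace ℝ (Fin n), ‖z‖ ≤ 2 → ∃ x ∈ N, ‖z - x‖ ≤ 1)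
    (M : Matrix (Fin n) (Fin n) ℝ) :
    ∃ x ∈ N, ∃ y ∈ N, opNorm M ≤ |x.ofLp ⬝ᵥ M *ᵥ y.ofLp| := by
  set T := toEuclideanCLM (𝕜 := ℝ) M with hT
  have hne : (N ×ˢ N).Nonempty := by
    obtain ⟨x, hx, -⟩ := hN 0 (by simp)
    exact ⟨(x, x), Finset.mem_product.2 ⟨hx, hx⟩⟩
  have hin : ∀ x y : EuclideanSpace ℝ (Fin n), inner ℝ x (T y) = x.ofLp ⬝ᵥ M *ᵥ y.ofLp := by
    intro x y
    have : T y = WithLp.toLp 2 (M *ᵥ y.ofLp) := rfl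
    rw [this, EuclideanSpace.inner_eq_star_dotProduct]
    simp [dotProduct_comm]
  obtain ⟨⟨x, y⟩, hxy, hmax⟩ := Finset.exists_max_image (N ×ˢ N)
    (fun z => |inner ℝ z.1 (T z.2)|) hne
  obtain ⟨hx, hy⟩ := Finset.mem_product.1 hxy
  refine ⟨x, hx, y, hy, ?_⟩
  rw [← hin]
  set K := |inner ℝ x (T y)|
  have hK : ∀ c ∈ N, ∀ d ∈ N, inner ℝ c (T d) ≤ K := fun c hc d hd =>
    (le_abs_self _).trans (hmax (c, d) (Finset.mem_product.2 ⟨hc, hd⟩))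
  -- Approximating `z = 2 T d / ‖T d‖` by a net point `c` gives `2‖T d‖ = ⟨z, T d⟩ ≤ K + ‖T d‖`.
  have hd : ∀ d ∈ N, ‖T d‖ ≤ K := by
    intro d hd
    rcases eq_or_ne (T d) 0 with h0 | h0
    · rw [h0, norm_zero]; exact abs_nonneg _
    have hpos : 0 < ‖T d‖ := norm_pos_iff.2 h0
    set z := (2 * ‖T d‖⁻¹) • T d with hz
    have hzn : ‖z‖ ≤ 2 := by
      rw [hz, norm_smul, Real.norm_eq_abs, abs_of_pos (by positivity)]
      field_simp
      exact le_rfl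
    obtain ⟨c, hc, hzc⟩ := hN z hzn
    have h1 : inner ℝ z (T d) = 2 * ‖T d‖ := by
      rw [hz, inner_smul_left, real_inner_self_eq_norm_sq]
      simp
      field_simp
    have h2 : inner ℝ (z - c) (T d) ≤ ‖T d‖ := by
      refine (real_inner_le_norm _ _).trans ?_
      nlinarith
    rw [inner_sub_left, h1] at h2
    linarith [hK c hc d hd]
  refine ContinuousLinearMap.opNorm_le_of_unit_norm (abs_nonneg _) ?_
  have hbound : ‖T‖ ≤ K := by
    -- The same trick in the other argument: for a unit vector `w`, `2w` is within 1 of a net point.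
    have h3 : ‖T‖ ≤ (K + ‖T‖) / 2 := by
      refine ContinuousLinearMap.opNorm_le_of_unit_norm
        (by have := norm_nonneg T; have := abs_nonneg (inner ℝ x (T y)); positivity) fun w hw => ?_
      obtain ⟨d, hdN, hwd⟩ := hN ((2 : ℝ) • w) (by rw [norm_smul, hw]; simp)
      have h4 : ‖T ((2 : ℝ) • w)‖ ≤ ‖T d‖ + ‖T‖ := by
        have : T ((2 : ℝ) • w) = T d + T ((2 : ℝ) • w - d) := by rw [← map_add]; congr 1; abel
        rw [this]
        refine (norm_add_le _ _).trans (add_le_add le_rfl ?_)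
        exact (T.le_opNorm _).trans (mul_le_of_le_one_right (norm_nonneg _) hwd)
      rw [map_smul, norm_smul, Real.norm_eq_abs, abs_two] at h4
      linarith [hd d hdN]
    linarith
  intro w hw
  exact (T.le_opNorm w).trans (by rw [hw, mul_one]; exact hbound)

theorem sum_sum_eq_sum_edgeIndex {f : Fin n → Fin n → ℝ} (hf : ∀ i, f i i = 0) :
    ∑ i, ∑ j, f i j = ∑ e : EdgeIndex n, (f e.1.1 e.1.2 + f e.1.2 e.1.1) := by
  have h : ∀ g : Fin n × Fin n → ℝ,
      ∑ e : EdgeIndex n, g e.1 = ∑ p, if p.1 < p.2 then g p else 0 := fun g => by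
    rw [← Finset.sum_filter]
    exact (Finset.sum_subtype _ (by simp) g).symm
  rw [h fun p => f p.1 p.2 + f p.2 p.1, ← Fintype.sum_prod_type']
  have h2 : ∀ p : Fin n × Fin n, f p.1 p.2 =
      (if p.1 < p.2 then f p.1 p.2 else 0) + if p.2 < p.1 then f p.1 p.2 else 0 := fun p => by
    rcases lt_trichotomy p.1 p.2 with h | h | h
    · simp [h, h.not_gt]
    · simp [h, hf]
    · simp [h, h.not_gt]
  rw [Finset.sum_congr rfl fun p _ => h2 p, Finset.sum_add_distrib,
    ← (Equiv.prodComm (Fin n) (Fin n)).sum_comp fun p => if p.2 < p.1 then f p.1 p.2 else 0,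
    ← Finset.sum_add_distrib]
  refine Finset.sum_congr rfl fun p _ => ?_
  by_cases h : p.1 < p.2 <;> simp [h]

theorem dotProduct_edgeMatrix_mulVec (w : EdgeIndex n → ℝ) (x y : Fin n → ℝ) :
    x ⬝ᵥ edgeMatrix w *ᵥ y = ∑ e : EdgeIndex n, (x e.1.1 * y e.1.2 + x e.1.2 * y e.1.1) * w e := by
  rw [← traceInner_vecMulVec, traceInner_eq_sum,
    sum_sum_eq_sum_edgeIndex (by simp [edgeMatrix_self])]
  refine Finset.sum_congr rfl fun e _ => ?_
  rw [edgeMatrix_of_lt _ e.2, edgeMatrix_of_gt _ e.2, vecMulVec_apply, vecMulVec_apply]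
  ring

theorem sum_edgeIndex_sq_le (x y : Fin n → ℝ) :
    ∑ e : EdgeIndex n, (x e.1.1 * y e.1.2 + x e.1.2 * y e.1.1) ^ 2 ≤
      2 * ((x ⬝ᵥ x) * (y ⬝ᵥ y)) := by
  set f : Fin n → Fin n → ℝ := fun i j => if i = j then 0 else x i * x i * (y j * y j) with hf
  calc ∑ e : EdgeIndex n, (x e.1.1 * y e.1.2 + x e.1.2 * y e.1.1) ^ 2
      ≤ ∑ e : EdgeIndex n, 2 * (f e.1.1 e.1.2 + f e.1.2 e.1.1) := by
        refine Finset.sum_le_sum fun e _ => ?_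
        simp only [hf, if_neg e.2.ne, if_neg e.2.ne']
        nlinarith [sq_nonneg (x e.1.1 * y e.1.2 - x e.1.2 * y e.1.1)]
    _ = 2 * ∑ i, ∑ j, f i j := by
        rw [← Finset.mul_sum, sum_sum_eq_sum_edgeIndex fun i => by simp [hf]]
    _ ≤ _ := by
        simp only [dotProduct, Finset.sum_mul_sum]
        gcongr with i _ j _
        simp only [hf]
        split_ifs
        · exact mul_nonneg (mul_self_nonneg _) (mul_self_nonneg _)
        · exact le_rfl

/-! ### A bounded comparison ensemble -/

/-- The biased coin giving `true` with probability `1/5`. -/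
noncomputable def coinMeasure : Measure Bool :=
  (1 / 5 : NNReal) • Measure.dirac true + (4 / 5 : NNReal) • Measure.dirac false

instance : IsProbabilityMeasure coinMeasure where
  measure_univ := by
    simp only [coinMeasure, Measure.add_apply, Measure.smul_apply, measure_univ]
    rw [← add_smul, ENNReal.smul_def]
    norm_num

/-- The value `2` on `true` and `-1/2` on `false`. -/
noncomputable def coinValue (x : Bool) : ℝ := if x then 2 else -1 / 2

theorem integral_coinMeasure (f : Bool → ℝ) :
    ∫ x, f x ∂coinMeasure = 1 / 5 * f true + 4 / 5 * f false := by
  rw [coinMeasure, integral_add_measure Integrable.of_finite Integrable.of_finite,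
    integral_smul_nnreal_measure, integral_smul_nnreal_measure, integral_dirac, integral_dirac]
  simp [NNReal.smul_def]

theorem integral_coinValue : ∫ x, coinValue x ∂coinMeasure = 0 := by
  rw [integral_coinMeasure]
  norm_num [coinValue]

/-- The second moment is exactly one. For `r ≥ 3` heads contribute at least `8/5` and tails at least
`-1/10`. The asymmetry of the coin is essential, since odd moments must be at least one too. -/
theorem one_le_integral_coinValue_pow {r : ℕ} (hr : 2 ≤ r) :
    1 ≤ ∫ x, coinValue x ^ r ∂coinMeasure := by
  rw [integral_coinMeasure]
  simp only [coinValue, if_true, Bool.false_eq_true, if_false]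
  obtain ⟨s, rfl⟩ := Nat.exists_eq_add_of_le hr
  rcases Nat.eq_zero_or_pos s with rfl | hs
  · norm_num
  have h1 : (8 : ℝ) ≤ 2 ^ (2 + s) := by
    calc (8 : ℝ) = 2 ^ 3 := by norm_num
      _ ≤ 2 ^ (2 + s) := pow_le_pow_right₀ (by norm_num) (by omega)
  have h2 : |(-1 / 2 : ℝ) ^ (2 + s)| ≤ 1 / 8 := by
    rw [abs_pow]
    calc |(-1 / 2 : ℝ)| ^ (2 + s) = (1 / 2) ^ (2 + s) := by norm_num [abs_of_neg]
      _ ≤ (1 / 2) ^ 3 := pow_le_pow_of_le_one (by norm_num) (by norm_num) (by omega)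
      _ = 1 / 8 := by norm_num
  linarith [(abs_le.1 h2).1]

/-- The law of independent biased coins on the edges of a complete graph. -/
noncomputable def coinProduct (m : ℕ) : Measure (EdgeIndex m → Bool) := Measure.pi fun _ => coinMeasure

instance (m : ℕ) : IsProbabilityMeasure (coinProduct m) := by
  unfold coinProduct; infer_instance

/-- The coin attached to an edge. -/
noncomputable def coinVar (m : ℕ) (e : EdgeIndex m) (ω : EdgeIndex m → Bool) : ℝ := coinValue (ω e)

theorem measurable_coinVar (m : ℕ) (e : EdgeIndex m) : Measurable (coinVar m e) :=
  measurable_of_finite _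

theorem iIndepFun_coinVar (m : ℕ) : iIndepFun (coinVar m) (coinProduct m) :=
  iIndepFun_pi (X := fun _ => coinValue) fun _ => (measurable_of_finite _).aemeasurable

theorem integral_coinVar_pow (m : ℕ) (e : EdgeIndex m) (r : ℕ) :
    ∫ ω, coinVar m e ω ^ r ∂coinProduct m = ∫ x, coinValue x ^ r ∂coinMeasure :=
  integral_comp_eval (μ := fun _ : EdgeIndex m => coinMeasure) (f := fun x => coinValue x ^ r)
    (measurable_of_finite _).aestronglyMeasurable

theorem coinVar_mem_Icc (m : ℕ) (e : EdgeIndex m) (ω : EdgeIndex m → Bool) :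
    coinVar m e ω ∈ Set.Icc (-1 / 2 : ℝ) 2 := by
  rw [coinVar, coinValue]
  split_ifs <;> norm_num

/-- Even moments of a sub-Gaussian variable. -/
theorem integral_pow_le_of_hasSubgaussianMGF {Ω : Type*} [MeasurableSpace Ω] {μ : Measure Ω}
    {Z : Ω → ℝ} {c : NNReal} (h : HasSubgaussianMGF Z c μ) {q : ℕ} (hq : 1 ≤ q) :
    ∫ ω, Z ω ^ (2 * q) ∂μ ≤ 2 * (4 * Real.exp (c / 2) * q) ^ q := by
  have hq' : (0 : ℝ) < q := by exact_mod_cast hq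
  -- This choice makes the moment generating function `e^{ct²/2} = (e^{c/2})^q` match the order of
  -- the moment.
  set t := √(q : ℝ) with ht
  have ht2 : t ^ 2 = q := Real.sq_sqrt hq'.le
  have hpt : ∀ ω, Z ω ^ (2 * q) ≤
      (4 * q) ^ q * (Real.exp (t * Z ω) + Real.exp (-t * Z ω)) := fun ω => by
    have h1 := Real.pow_div_factorial_le_exp (x := |t * Z ω|) (abs_nonneg _) (2 * q)
    have h2 : Real.exp |t * Z ω| ≤ Real.exp (t * Z ω) + Real.exp (-t * Z ω) := by
      rcases abs_cases (t * Z ω) with ⟨h, -⟩ | ⟨h, -⟩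
      · rw [h]; linarith [Real.exp_pos (-t * Z ω)]
      · rw [h, neg_mul]; linarith [Real.exp_pos (t * Z ω)]
    have h3 : |t * Z ω| ^ (2 * q) = q ^ q * Z ω ^ (2 * q) := by
      rw [pow_mul, sq_abs, mul_pow, ht2, mul_pow, ← pow_mul]
    rw [div_le_iff₀ (by positivity), h3] at h1
    have h4 : (((2 * q).factorial : ℕ) : ℝ) ≤ q ^ q * (4 * q) ^ q := by
      calc (((2 * q).factorial : ℕ) : ℝ) ≤ ((2 * q : ℕ) : ℝ) ^ (2 * q) := by
            exact_mod_cast Nat.factorial_le_pow (2 * q)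
        _ = _ := by rw [pow_mul, ← mul_pow]; push_cast; ring
    have h5 : (q : ℝ) ^ q * Z ω ^ (2 * q) ≤
        q ^ q * ((4 * q) ^ q * (Real.exp (t * Z ω) + Real.exp (-t * Z ω))) := by
      calc (q : ℝ) ^ q * Z ω ^ (2 * q) ≤ Real.exp |t * Z ω| * ((2 * q).factorial : ℕ) := h1
        _ ≤ (Real.exp (t * Z ω) + Real.exp (-t * Z ω)) * (q ^ q * (4 * q) ^ q) := by gcongr
        _ = _ := by ring
    exact le_of_mul_le_mul_left h5 (by positivity)
  have hint : Integrable (fun ω => Real.exp (t * Z ω) + Real.exp (-t * Z ω)) μ :=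
    (h.integrable_exp_mul t).add (h.integrable_exp_mul (-t))
  calc ∫ ω, Z ω ^ (2 * q) ∂μ
      ≤ ∫ ω, (4 * q) ^ q * (Real.exp (t * Z ω) + Real.exp (-t * Z ω)) ∂μ :=
        integral_mono_of_nonneg (ae_of_all _ fun ω => by simp only [Pi.zero_apply, pow_mul]; positivity)
          (hint.const_mul _) (ae_of_all _ hpt)
    _ = (4 * q) ^ q * (mgf Z μ t + mgf Z μ (-t)) := by
        rw [integral_const_mul, integral_add (h.integrable_exp_mul t) (h.integrable_exp_mul (-t))]
        rfl
    _ ≤ (4 * q) ^ q * (Real.exp (c / 2) ^ q + Real.exp (c / 2) ^ q) := by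
        have e : ∀ s : ℝ, s ^ 2 = q → mgf Z μ s ≤ Real.exp (c / 2) ^ q := fun s hs => by
          refine (h.mgf_le s).trans (le_of_eq ?_)
          rw [← Real.exp_nat_mul, hs]
          congr 1
          ring
        gcongr
        · exact e t ht2
        · exact e (-t) (by rw [neg_sq, ht2])
    _ = _ := by rw [mul_pow (4 * Real.exp (c / 2)), mul_pow, mul_pow]; ring

/-- The constant in the moment bound for the comparison ensemble. -/
noncomputable def momentConst : ℝ := 2500 * Real.exp 25

/-- The `2q`-th power of the maximum over pairs of net points is bounded by the sum of `2q`-th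
powers. The `5^{2q} · 5^{2q} = 625^q` pairs cost only a constant to the power `q`, because the
dimension is itself `2q`. -/
theorem integral_opNorm_pow_coin_le {q : ℕ} (hq : 1 ≤ q) :
    ∫ ω, opNorm (edgeMatrix fun e => coinVar (2 * q) e ω) ^ (2 * q) ∂coinProduct (2 * q) ≤
      2 * (momentConst * q) ^ q := by
  obtain ⟨N, hcard, hN2, hN⟩ := exists_net (2 * q)
  set Y : (EdgeIndex (2 * q) → Bool) → Matrix (Fin (2 * q)) (Fin (2 * q)) ℝ :=
    fun ω => edgeMatrix fun e => coinVar (2 * q) e ω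
  have hpt : ∀ ω, opNorm (Y ω) ^ (2 * q) ≤
      ∑ z ∈ N ×ˢ N, (z.1.ofLp ⬝ᵥ Y ω *ᵥ z.2.ofLp) ^ (2 * q) := fun ω => by
    obtain ⟨x, hx, y, hy, hxy⟩ := exists_opNorm_le_of_net hN (Y ω)
    have h1 := pow_le_pow_left₀ (opNorm_nonneg _) hxy (2 * q)
    rw [pow_mul |_|, sq_abs, ← pow_mul] at h1
    refine h1.trans (Finset.single_le_sum
      (f := fun z : EuclideanSpace ℝ (Fin (2 * q)) × EuclideanSpace ℝ (Fin (2 * q)) =>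
        (z.1.ofLp ⬝ᵥ Y ω *ᵥ z.2.ofLp) ^ (2 * q)) (fun z _ => ?_)
      (Finset.mem_product.2 ⟨hx, hy⟩ : (x, y) ∈ N ×ˢ N))
    rw [pow_mul]
    positivity
  have hz : ∀ z ∈ N ×ˢ N, ∫ ω, (z.1.ofLp ⬝ᵥ Y ω *ᵥ z.2.ofLp) ^ (2 * q) ∂coinProduct (2 * q) ≤
      2 * (4 * Real.exp 25 * q) ^ q := fun z hzN => by
    obtain ⟨hx, hy⟩ := Finset.mem_product.1 hzN
    obtain ⟨c, hc, hsub⟩ := exists_hasSubgaussianMGF_sum (iIndepFun_coinVar (2 * q))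
      (measurable_coinVar _) (fun e => by
        have := integral_coinVar_pow (2 * q) e 1
        simpa [integral_coinValue] using this) (coinVar_mem_Icc _) (r := 5 / 2)
      (fun _ => by norm_num)
      (fun e => z.1.ofLp e.1.1 * z.2.ofLp e.1.2 + z.1.ofLp e.1.2 * z.2.ofLp e.1.1)
    have h1 := integral_pow_le_of_hasSubgaussianMGF hsub hq
    simp only [← dotProduct_edgeMatrix_mulVec] at h1
    refine h1.trans ?_
    have hsq : ∀ x : EuclideanSpace ℝ (Fin (2 * q)), ‖x‖ ≤ 2 → x.ofLp ⬝ᵥ x.ofLp ≤ 4 := by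
      intro x hx
      have : ‖x‖ = √(x.ofLp ⬝ᵥ x.ofLp) := norm_toLp_eq x.ofLp
      rw [this, Real.sqrt_le_iff] at hx
      linarith [hx.2]
    -- The entries range over an interval of length `5/2` and the squared coefficients sum to at
    -- most `2 · 4 · 4 = 32`, so `c ≤ (5/4)² · 32 = 50`.
    have hc25 : (c : ℝ) / 2 ≤ 25 := by
      have h2 := sum_edgeIndex_sq_le z.1.ofLp z.2.ofLp
      have h3 : (z.1.ofLp ⬝ᵥ z.1.ofLp) * (z.2.ofLp ⬝ᵥ z.2.ofLp) ≤ 4 * 4 :=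
        mul_le_mul (hsq _ (hN2 _ hx)) (hsq _ (hN2 _ hy)) (dotProduct_self_nonneg_real _)
          (by norm_num)
      rw [hc]
      linarith
    gcongr
  calc _ ≤ ∫ ω, ∑ z ∈ N ×ˢ N, (z.1.ofLp ⬝ᵥ Y ω *ᵥ z.2.ofLp) ^ (2 * q) ∂coinProduct (2 * q) :=
        integral_mono Integrable.of_finite Integrable.of_finite hpt
    _ = ∑ z ∈ N ×ˢ N, ∫ ω, (z.1.ofLp ⬝ᵥ Y ω *ᵥ z.2.ofLp) ^ (2 * q) ∂coinProduct (2 * q) :=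
        integral_finsetSum _ fun _ _ => Integrable.of_finite
    _ ≤ ∑ z ∈ N ×ˢ N, 2 * (4 * Real.exp 25 * q) ^ q := Finset.sum_le_sum hz
    _ = ((N.card : ℝ) * N.card) * (2 * (4 * Real.exp 25 * q) ^ q) := by
        rw [Finset.sum_const, Finset.card_product, nsmul_eq_mul, Nat.cast_mul]
    _ ≤ (5 ^ (2 * q) * 5 ^ (2 * q)) * (2 * (4 * Real.exp 25 * q) ^ q) := by
        have : (N.card : ℝ) ≤ 5 ^ (2 * q) := by exact_mod_cast hcard
        gcongr
    _ = 2 * (momentConst * q) ^ q := by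
        have : momentConst * q = 625 * (4 * Real.exp 25 * q) := by rw [momentConst]; ring
        rw [this, mul_pow 625, pow_mul, ← mul_pow]
        norm_num
        ring

open Classical in
-- A combinatorial count obtained by probability: the number of walks is at most the expected trace
-- for the coin matrix, hence at most its size times the moment of its norm.
theorem card_doubledWalk_le (j : ℕ) :
    ∑ u : Fin (2 * 2 ^ j + 1) → Fin (2 * 2 ^ j), (if IsDoubledWalk u then (1 : ℝ) else 0) ≤
      (2 * 2 ^ j : ℕ) * (2 * (momentConst * (2 ^ j : ℕ)) ^ 2 ^ j) := by
  have hq : 1 ≤ 2 ^ j := Nat.one_le_two_pow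
  refine (le_integral_trace_pow (iIndepFun_coinVar (2 * 2 ^ j)) (measurable_coinVar _) (b := 2)
    (fun e ω => ?_) (by norm_num) (fun e => ?_) (fun e r hr => ?_) (2 * 2 ^ j)).trans ?_
  · have := coinVar_mem_Icc _ e ω
    exact abs_le.2 ⟨by linarith [this.1], this.2⟩
  · have := integral_coinVar_pow (2 * 2 ^ j) e 1
    simpa [integral_coinValue] using this
  · rw [integral_coinVar_pow]
    exact one_le_integral_coinValue_pow hr
  · calc _ ≤ ∫ ω, ((2 * 2 ^ j : ℕ) : ℝ) *
          opNorm (edgeMatrix fun e => coinVar (2 * 2 ^ j) e ω) ^ (2 * 2 ^ j)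
            ∂coinProduct (2 * 2 ^ j) :=
          integral_mono Integrable.of_finite Integrable.of_finite fun ω =>
            trace_pow_le_opNorm_pow (edgeMatrix_transpose _) j
      _ ≤ _ := by
          rw [integral_const_mul]
          gcongr
          exact integral_opNorm_pow_coin_le hq

/-! ### Concentration of the operator norm -/

section Concentration

variable {Ω : Type*} [MeasurableSpace Ω] {μ : Measure Ω} {W : EdgeIndex n → Ω → ℝ}

theorem integral_trace_pow_le_of_sparse [IsProbabilityMeasure μ] (hi : iIndepFun W μ)
    (hm : ∀ e, Measurable (W e)) (hb : ∀ e ω, |W e ω| ≤ 1) {p : ℝ} (hp0 : 0 ≤ p) (hp1 : p ≤ 1)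
    (hmean : ∀ e, ∫ ω, W e ω ∂μ = 0) (hmom : ∀ e r, 2 ≤ r → |∫ ω, W e ω ^ r ∂μ| ≤ p) {j : ℕ}
    (hnp : n * p ≤ (2 ^ j : ℕ)) :
    ∫ ω, (edgeMatrix (fun e => W e ω) ^ (2 * 2 ^ j)).trace ∂μ ≤
      2 * n * (momentConst * (2 ^ j : ℕ)) ^ 2 ^ j := by
  classical
  have hq : 1 ≤ 2 ^ j := Nat.one_le_two_pow
  calc _ ≤ _ := integral_trace_pow_le hi hm hb zero_le_one hp0 hp1 hmean hmom _
    _ ≤ _ := sum_doubledWalk_le hp0 hnp hq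
    _ ≤ n / (2 * 2 ^ j : ℕ) * ((2 * 2 ^ j : ℕ) * (2 * (momentConst * (2 ^ j : ℕ)) ^ 2 ^ j)) := by
        gcongr
        exact card_doubledWalk_le j
    _ = _ := by
        have : ((2 * 2 ^ j : ℕ) : ℝ) ≠ 0 := by positivity
        field_simp

/-- Markov's inequality for the trace. The extra factor `e^4` in the threshold gains `e^{-4q} ≤
n^{-4}`, which beats the factor `2n` in the moment bound. -/
theorem measure_opNorm_edgeMatrix_ge_le [IsProbabilityMeasure μ] (hi : iIndepFun W μ)
    (hm : ∀ e, Measurable (W e)) (hb : ∀ e ω, |W e ω| ≤ 1) {p : ℝ} (hp0 : 0 ≤ p) (hp1 : p ≤ 1)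
    (hmean : ∀ e, ∫ ω, W e ω ∂μ = 0) (hmom : ∀ e r, 2 ≤ r → |∫ ω, W e ω ^ r ∂μ| ≤ p) {j : ℕ}
    (hn : 1 ≤ n) (hnp : n * p ≤ (2 ^ j : ℕ)) (hlog : Real.log n ≤ (2 ^ j : ℕ)) :
    μ.real {ω | √(Real.exp 4 * momentConst * (2 ^ j : ℕ)) ≤ opNorm (edgeMatrix fun e => W e ω)} ≤
      2 / (n : ℝ) ^ 3 := by
  set q : ℕ := 2 ^ j with hq
  have hq1 : 1 ≤ q := Nat.one_le_two_pow
  have hq0 : (0 : ℝ) < q := by exact_mod_cast hq1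
  have hn0 : (0 : ℝ) < n := by exact_mod_cast hn
  have hmc : 0 < momentConst := by unfold momentConst; positivity
  set S := Real.exp 4 * momentConst * q with hS
  have hS0 : 0 < S := by positivity
  have hmark := mul_meas_ge_le_integral_of_nonneg
    (μ := μ) (f := fun ω => (edgeMatrix (fun e => W e ω) ^ (2 * q)).trace)
    (ae_of_all _ fun ω => by
      simp only [Pi.zero_apply]
      rw [← frobNorm_pow_sq (edgeMatrix_transpose _)]; exact sq_nonneg _)
    (integrable_trace_pow hm hb zero_le_one _) (S ^ q)
  have hsub : {ω | √S ≤ opNorm (edgeMatrix fun e => W e ω)} ⊆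
      {ω | S ^ q ≤ (edgeMatrix (fun e => W e ω) ^ (2 * q)).trace} := fun ω hω => by
    have h1 := pow_le_pow_left₀ (Real.sqrt_nonneg S) hω (2 * q)
    rw [pow_mul, Real.sq_sqrt hS0.le] at h1
    exact h1.trans (opNorm_pow_le_trace (edgeMatrix_transpose _) j)
  have h2 := hmark.trans (integral_trace_pow_le_of_sparse hi hm hb hp0 hp1 hmean hmom hnp)
  have h3 : μ.real {ω | S ^ q ≤ (edgeMatrix (fun e => W e ω) ^ (2 * q)).trace} ≤
      2 * n * (momentConst * q) ^ q / S ^ q := by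
    rw [le_div_iff₀ (by positivity), mul_comm]
    exact h2
  refine (measureReal_mono hsub).trans (h3.trans ?_)
  have h4 : S ^ q = Real.exp (q : ℝ) ^ 4 * (momentConst * q) ^ q := by
    rw [hS, mul_assoc, mul_pow, ← Real.exp_nat_mul, ← Real.exp_nat_mul]
    congr 2
    push_cast
    ring
  have h5 : (n : ℝ) ≤ Real.exp q := by
    rw [← Real.exp_log hn0]; exact Real.exp_le_exp.2 hlog
  have h6 : (n : ℝ) ^ 4 ≤ Real.exp (q : ℝ) ^ 4 := pow_le_pow_left₀ hn0.le h5 4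
  rw [h4, mul_div_mul_right _ _ (by positivity), div_le_div_iff₀ (by positivity) (by positivity)]
  calc (2 * n * n ^ 3 : ℝ) = 2 * n ^ 4 := by ring
    _ ≤ _ := by gcongr

end Concentration

/-! ### The noise matrix of a random network -/

section Network

variable {Ω : Type*} [MeasurableSpace Ω] {μ : Measure Ω} {P : Matrix (Fin n) (Fin n) ℝ}
  {A : Ω → Matrix (Fin n) (Fin n) ℝ}

/-- The centered edge indicators. -/
def edgeNoise (P : Matrix (Fin n) (Fin n) ℝ) (A : Ω → Matrix (Fin n) (Fin n) ℝ)
    (e : EdgeIndex n) (ω : Ω) : ℝ :=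
  A ω e.1.1 e.1.2 - P e.1.1 e.1.2

theorem IsRandomNetwork.measurable_edgeNoise (h : IsRandomNetwork μ P A) (e : EdgeIndex n) :
    Measurable (edgeNoise P A e) :=
  (h.measurable _ _).sub_const _

theorem IsRandomNetwork.iIndepFun_edgeNoise (h : IsRandomNetwork μ P A) :
    iIndepFun (edgeNoise P A) μ :=
  h.indep.comp (fun e x => x - P e.1.1 e.1.2) fun _ => measurable_id.sub_const _

theorem IsRandomNetwork.integral_apply (h : IsRandomNetwork μ P A) (e : EdgeIndex n) :
    ∫ ω, A ω e.1.1 e.1.2 ∂μ = P e.1.1 e.1.2 := by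
  have hs : MeasurableSet {ω | A ω e.1.1 e.1.2 = 1} :=
    h.measurable _ _ (measurableSet_singleton (1 : ℝ))
  rw [← h.prob _ _ e.2, ← integral_indicator_one hs]
  refine integral_congr_ae (ae_of_all _ fun ω => ?_)
  rcases (h.adj ω).zero_or_one e.1.1 e.1.2 with h0 | h0 <;> simp [Set.indicator, h0]

theorem IsRandomNetwork.integrable_apply [IsProbabilityMeasure μ] (h : IsRandomNetwork μ P A)
    (e : EdgeIndex n) : Integrable (fun ω => A ω e.1.1 e.1.2) μ := by
  refine Integrable.of_bound (C := 1) (h.measurable _ _).aestronglyMeasurable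
    (ae_of_all _ fun ω => ?_)
  rcases (h.adj ω).zero_or_one e.1.1 e.1.2 with h0 | h0 <;> simp [h0]

theorem IsRandomNetwork.integral_edgeNoise [IsProbabilityMeasure μ] (h : IsRandomNetwork μ P A)
    (e : EdgeIndex n) : ∫ ω, edgeNoise P A e ω ∂μ = 0 := by
  simp only [edgeNoise]
  rw [integral_sub (h.integrable_apply e) (integrable_const _), h.integral_apply]
  simp

theorem IsRandomNetwork.edgeNoise_mem_Icc (h : IsRandomNetwork μ P A) (e : EdgeIndex n) (ω : Ω) :
    edgeNoise P A e ω ∈ Set.Icc (-P e.1.1 e.1.2) (1 - P e.1.1 e.1.2) := by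
  rcases (h.adj ω).zero_or_one e.1.1 e.1.2 with h0 | h0 <;> simp [edgeNoise, h0]

theorem IsRandomNetwork.abs_edgeNoise_le (h : IsRandomNetwork μ P A) (hP0 : ∀ i j, 0 ≤ P i j)
    (hP1 : ∀ i j, P i j ≤ 1) (e : EdgeIndex n) (ω : Ω) : |edgeNoise P A e ω| ≤ 1 := by
  have h1 := h.edgeNoise_mem_Icc e ω
  exact abs_le.2 ⟨by linarith [h1.1, hP1 e.1.1 e.1.2], by linarith [h1.2, hP0 e.1.1 e.1.2]⟩

theorem IsRandomNetwork.abs_integral_edgeNoise_pow_le [IsProbabilityMeasure μ]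
    (h : IsRandomNetwork μ P A) (hP0 : ∀ i j, 0 ≤ P i j) (hP1 : ∀ i j, P i j ≤ 1)
    (e : EdgeIndex n) {r : ℕ} (hr : 2 ≤ r) :
    |∫ ω, edgeNoise P A e ω ^ r ∂μ| ≤ P e.1.1 e.1.2 := by
  set x := P e.1.1 e.1.2 with hx
  have hA := h.integrable_apply e
  calc |∫ ω, edgeNoise P A e ω ^ r ∂μ| ≤ ∫ ω, |edgeNoise P A e ω ^ r| ∂μ :=
        abs_integral_le_integral_abs
    -- Since the noise is at most one in size, higher powers reduce to the square, and `A² = A`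
    -- makes `(A - x)²` affine in `A`. The result is the Bernoulli variance.
    _ ≤ ∫ ω, ((1 - 2 * x) * A ω e.1.1 e.1.2 + x ^ 2) ∂μ := by
        refine integral_mono_of_nonneg (ae_of_all _ fun ω => abs_nonneg _)
          ((hA.const_mul _).add (integrable_const _)) (ae_of_all _ fun ω => ?_)
        have h1 : |edgeNoise P A e ω ^ r| ≤ edgeNoise P A e ω ^ 2 := by
          rw [abs_pow, ← sq_abs (edgeNoise P A e ω)]
          exact pow_le_pow_of_le_one (abs_nonneg _) (h.abs_edgeNoise_le hP0 hP1 e ω) hr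
        refine h1.trans (le_of_eq ?_)
        rcases (h.adj ω).zero_or_one e.1.1 e.1.2 with h0 | h0 <;>
          simp only [edgeNoise, h0, ← hx] <;> ring
    _ = (1 - 2 * x) * x + x ^ 2 := by
        rw [integral_add (hA.const_mul _) (integrable_const _), integral_const_mul,
          h.integral_apply]
        simp [hx]
    _ ≤ x := by nlinarith [hP0 e.1.1 e.1.2]

theorem IsRandomNetwork.sub_eq (h : IsRandomNetwork μ P A) (hP : Pᵀ = P) (ω : Ω) :
    A ω - P = edgeMatrix (fun e => edgeNoise P A e ω) + diagonal fun i => -P i i := by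
  have hA : (A ω)ᵀ = A ω := (h.adj ω).symm
  ext i j
  rw [Matrix.sub_apply, Matrix.add_apply]
  rcases lt_trichotomy i j with hij | rfl | hij
  · rw [edgeMatrix_of_lt _ hij, diagonal_apply_ne _ hij.ne]
    simp [edgeNoise]
  · rw [edgeMatrix_self, diagonal_apply_eq, (h.adj ω).apply_diag]
    ring
  · rw [edgeMatrix_of_gt _ hij, diagonal_apply_ne _ hij.ne']
    have h1 : A ω j i = A ω i j := congrFun (congrFun hA i) j
    have h2 : P j i = P i j := congrFun (congrFun hP i) j
    simp [edgeNoise, h1, h2]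

theorem IsRandomNetwork.opNorm_sub_le (h : IsRandomNetwork μ P A) (hP : Pᵀ = P)
    (hP0 : ∀ i j, 0 ≤ P i j) (hP1 : ∀ i j, P i j ≤ 1) (ω : Ω) :
    opNorm (A ω - P) ≤ opNorm (edgeMatrix fun e => edgeNoise P A e ω) + 1 := by
  rw [h.sub_eq hP]
  refine (opNorm_add_le _ _).trans (add_le_add le_rfl (opNorm_diagonal_le zero_le_one fun i => ?_))
  rw [abs_neg, abs_of_nonneg (hP0 i i)]
  exact hP1 i i

/-- The operator norm of the noise is of order `√(max {n p, log n})`. -/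
theorem IsRandomNetwork.measure_opNorm_ge_le [IsProbabilityMeasure μ] (h : IsRandomNetwork μ P A)
    (hP : Pᵀ = P) (hP0 : ∀ i j, 0 ≤ P i j) {p : ℝ} (hp0 : 0 ≤ p) (hp1 : p ≤ 1)
    (hPp : ∀ i j, i < j → P i j ≤ p) (hP1 : ∀ i j, P i j ≤ 1) (hn : 2 ≤ n) :
    μ.real {ω | √(2 * Real.exp 4 * momentConst * max (n * p) (Real.log n)) + 1 <
      opNorm (A ω - P)} ≤ 2 / (n : ℝ) ^ 3 := by
  set d := max (n * p) (Real.log n) with hd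
  have hn2 : (2 : ℝ) ≤ n := by exact_mod_cast hn
  have hd1 : 1 ≤ 2 * d := by
    have h1 : Real.log 2 ≤ Real.log n := Real.log_le_log (by norm_num) hn2
    have h2 := Real.log_two_gt_d9
    have h3 : Real.log n ≤ d := le_max_right _ _
    linarith
  -- The power of two with `d < 2^j ≤ 2d`; it exists because `n ≥ 2` gives `2d ≥ 2 log 2 > 1`.
  obtain ⟨j, hj1, hj2⟩ := exists_nat_pow_near hd1 (one_lt_two (α := ℝ))
  rw [pow_succ] at hj2
  have hq1 : d ≤ (2 ^ j : ℕ) := by push_cast; linarith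
  have hq2 : ((2 ^ j : ℕ) : ℝ) ≤ 2 * d := by push_cast; exact hj1
  have hmc : 0 ≤ momentConst := by unfold momentConst; positivity
  refine (measureReal_mono fun ω hω => ?_).trans (measure_opNorm_edgeMatrix_ge_le (j := j)
    h.iIndepFun_edgeNoise h.measurable_edgeNoise (h.abs_edgeNoise_le hP0 hP1) hp0 hp1
    h.integral_edgeNoise
    (fun e r hr => (h.abs_integral_edgeNoise_pow_le hP0 hP1 e hr).trans (hPp _ _ e.2))
    (by omega) ((le_max_left _ _).trans hq1) ((le_max_right _ _).trans hq1))
  have h1 := h.opNorm_sub_le hP hP0 hP1 ω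
  have h2 : √(Real.exp 4 * momentConst * (2 ^ j : ℕ)) ≤ √(2 * Real.exp 4 * momentConst * d) := by
    refine Real.sqrt_le_sqrt ?_
    calc _ ≤ Real.exp 4 * momentConst * (2 * d) := by gcongr
      _ = _ := by ring
  have hω' : √(2 * Real.exp 4 * momentConst * d) + 1 < opNorm (A ω - P) := hω
  change √(Real.exp 4 * momentConst * (2 ^ j : ℕ)) ≤ _
  linarith

/-- Hoeffding's bound for the covariate direction. -/
theorem IsRandomNetwork.measure_traceInner_ge_le [IsProbabilityMeasure μ]
    (h : IsRandomNetwork μ P A) (hP : Pᵀ = P) {X : Matrix (Fin n) (Fin n) ℝ} (hX : IsCovariate X)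
    (hX0 : X ≠ 0) (hn : 1 ≤ n) :
    μ.real {ω | 2 * √(Real.log n) < |traceInner (A ω - P) ((frobNorm X)⁻¹ • X)|} ≤
      2 / (n : ℝ) ^ 4 := by
  have hn0 : (0 : ℝ) < n := by exact_mod_cast hn
  have hf : frobNorm X ≠ 0 := fun h0 => hX0 (frobNorm_eq_zero h0)
  have hXs : ∀ i j, X j i = X i j := fun i j => congrFun (congrFun hX.1 i) j
  -- The factor 2 accounts for the two symmetric entries of each edge. The squares then sum to 2 and
  -- the variance proxy is `1/2`, so deviation `2√(log n)` has one-sided tail `n^{-4}`.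
  set a : EdgeIndex n → ℝ := fun e => 2 * (frobNorm X)⁻¹ * X e.1.1 e.1.2 with ha
  have hasq : ∑ e, a e ^ 2 = 2 := by
    have h1 := frobNorm_sq X
    rw [sum_sum_eq_sum_edgeIndex fun i => by rw [hX.2 i]; norm_num] at h1
    have h2 : ∀ e : EdgeIndex n, a e ^ 2 =
        2 * (frobNorm X ^ 2)⁻¹ * (X e.1.1 e.1.2 ^ 2 + X e.1.2 e.1.1 ^ 2) := fun e => by
      rw [hXs e.1.1 e.1.2]; simp only [ha]; field_simp; ring
    rw [Finset.sum_congr rfl fun e _ => h2 e, ← Finset.mul_sum, ← h1]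
    field_simp
  obtain ⟨c, hc, hsub⟩ := exists_hasSubgaussianMGF_sum h.iIndepFun_edgeNoise
    h.measurable_edgeNoise h.integral_edgeNoise h.edgeNoise_mem_Icc (r := 1)
    (fun _ => by ring) a
  rw [hasq] at hc
  have heq : ∀ ω, traceInner (A ω - P) ((frobNorm X)⁻¹ • X) = ∑ e, a e * edgeNoise P A e ω := by
    intro ω
    have hA : ∀ i j, A ω j i = A ω i j := fun i j => congrFun (congrFun (h.adj ω).symm i) j
    have hP' : ∀ i j, P j i = P i j := fun i j => congrFun (congrFun hP i) j
    rw [traceInner_eq_sum, sum_sum_eq_sum_edgeIndex fun i => by simp [hX.2 i]]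
    refine Finset.sum_congr rfl fun e _ => ?_
    simp only [Matrix.sub_apply, Matrix.smul_apply, smul_eq_mul, hA e.1.1 e.1.2, hP' e.1.1 e.1.2,
      hXs e.1.1 e.1.2, ha, edgeNoise]
    ring
  have hε : 0 ≤ 2 * √(Real.log n) := by positivity
  have htail : Real.exp (-(2 * √(Real.log n)) ^ 2 / (2 * c)) = 1 / (n : ℝ) ^ 4 := by
    rw [hc, mul_pow, Real.sq_sqrt (Real.log_natCast_nonneg n)]
    have : -(2 ^ 2 * Real.log n) / (2 * ((1 / 2) ^ 2 * 2)) = -((4 : ℕ) * Real.log n) := by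
      push_cast; ring
    rw [this, Real.exp_neg, Real.exp_nat_mul, Real.exp_log hn0, one_div]
  have h1 := hsub.measure_ge_le hε
  have h2 := hsub.neg.measure_ge_le hε
  rw [htail] at h1 h2
  have hsubset : {ω | 2 * √(Real.log n) < |traceInner (A ω - P) ((frobNorm X)⁻¹ • X)|} ⊆
      {ω | 2 * √(Real.log n) ≤ ∑ e, a e * edgeNoise P A e ω} ∪
      {ω | 2 * √(Real.log n) ≤ (-fun ω => ∑ e, a e * edgeNoise P A e ω) ω} := fun ω hω => by
    have hω' : 2 * √(Real.log n) < |traceInner (A ω - P) ((frobNorm X)⁻¹ • X)| := hω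
    rw [heq] at hω'
    rcases lt_abs.1 hω' with h3 | h3
    exacts [Or.inl h3.le, Or.inr h3.le]
  calc _ ≤ _ := measureReal_mono hsubset
    _ ≤ _ := measureReal_union_le _ _
    _ ≤ 1 / (n : ℝ) ^ 4 + 1 / (n : ℝ) ^ 4 := add_le_add h1 h2
    _ = _ := by ring

end Network

/-! ### Consequences of the model assumptions -/

theorem sigmoid_le_exp (x : ℝ) : Real.sigmoid x ≤ Real.exp x := by
  have h : Real.exp x = (Real.exp (-x))⁻¹ := by rw [Real.exp_neg, inv_inv]
  rw [h, Real.sigmoid_def]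
  exact inv_anti₀ (Real.exp_pos _) (by linarith)

theorem logitMatrix_transpose {X G : Matrix (Fin n) (Fin n) ℝ} (hX : X.IsSymm) (hG : Gᵀ = G)
    (α : Fin n → ℝ) (β : ℝ) : (logitMatrix X α β G)ᵀ = logitMatrix X α β G := by
  ext i j
  have h1 : X j i = X i j := congrFun (congrFun hX i) j
  have h2 : G j i = G i j := congrFun (congrFun hG i) j
  simp [logitMatrix, h1, h2]
  ring

theorem nuclearNorm_residual_le_trace {k : ℕ} {G B : Matrix (Fin n) (Fin n) ℝ}
    (hG : G.PosSemidef) (hB : IsBestRankApprox k G B) : nuclearNorm (G - B) ≤ G.trace := by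
  obtain ⟨P, hP, -, hres⟩ := hB.exists_orthProj
  rw [hres]
  exact nuclearNorm_proj_mul_le hP.compl hG

theorem natCast_le_of_stableRank {κ : ℝ} {X : Matrix (Fin n) (Fin n) ℝ} (hX : X ≠ 0)
    (h : κ ≤ stableRank X) : κ ≤ n := by
  refine h.trans ?_
  have h0 : opNorm X ≠ 0 := fun h0 => by
    have h1 := frobNorm_sq_le_opNorm_sq X
    rw [h0] at h1
    exact hX (frobNorm_eq_zero (pow_eq_zero_iff two_ne_zero |>.1
      (le_antisymm (by simpa using h1) (sq_nonneg _))))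
  rw [stableRank, div_le_iff₀ (by positivity)]
  exact frobNorm_sq_le_opNorm_sq X

/-- A covariate of large stable rank cannot carry the intercept, so `M₂` is bounded away
from `M₁`. -/
theorem InGeneralClass.le_of_stableRank {k : ℕ} {M₁ M₂ : ℝ} {X G : Matrix (Fin n) (Fin n) ℝ}
    {α : Fin n → ℝ} {β : ℝ} (hk : 1 ≤ k) (h0 : 0 ≤ M₂) (h1 : M₂ ≤ M₁) (hX : IsCovariate X)
    (hX0 : X ≠ 0) (hst : 10000 * (k : ℝ) ≤ stableRank X) (h : InGeneralClass M₁ M₂ X α β G) :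
    M₂ ≤ 3 / 4 * M₁ := by
  have hk' : (1 : ℝ) ≤ k := by exact_mod_cast hk
  have hn : (10000 : ℝ) ≤ n := by linarith [natCast_le_of_stableRank hX0 hst]
  have hn1 : 1 ≤ n := by
    have : (1 : ℝ) ≤ n := by linarith
    exact_mod_cast this
  have hM : 0 ≤ M₁ := h0.trans h1
  obtain ⟨hGd, hα, hβ⟩ := h.bounded_of_ne_zero hX0
  have hXs : ∀ i j, X j i = X i j := fun i j => congrFun (congrFun hX.1 i) j
  have hXb : ∀ i j, |(β • X) i j| ≤ M₁ / 3 := fun i j => by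
    rw [Matrix.smul_apply, smul_eq_mul, abs_mul]
    rcases lt_trichotomy i j with hij | rfl | hij
    · exact hβ i j hij
    · rw [hX.2 i]; simp; linarith
    · rw [← hXs]; exact hβ j i hij
  have hfrob : frobNorm (β • X) ≤ n * (M₁ / 3) := by
    refine le_of_sq_le_sq ?_ (by positivity)
    rw [frobNorm_sq]
    calc ∑ i, ∑ j, (β • X) i j ^ 2 ≤ ∑ i : Fin n, ∑ j : Fin n, (M₁ / 3) ^ 2 := by
          refine Finset.sum_le_sum fun i _ => Finset.sum_le_sum fun j _ => ?_
          rw [← sq_abs]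
          exact pow_le_pow_left₀ (abs_nonneg _) (hXb i j) 2
      _ = _ := by simp; ring
  have hop : 100 * opNorm (β • X) ≤ frobNorm (β • X) := by
    have h2 : 100 * opNorm X ≤ frobNorm X := by
      refine le_of_sq_le_sq ?_ (frobNorm_nonneg X)
      have := opNorm_sq_le_of_stableRank (M₀ := 10000) (κ := k) fun _ => hst
      nlinarith [sq_nonneg (opNorm X)]
    rw [opNorm_smul, frobNorm_smul]
    nlinarith [mul_le_mul_of_nonneg_left h2 (abs_nonneg β)]
  have hsumX : |∑ i, ∑ j, (β • X) i j| ≤ n * (n * (M₁ / 300)) := by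
    have h2 := abs_dotProduct_mulVec_le (β • X) 1 1
    have h3 : (1 : Fin n → ℝ) ⬝ᵥ 1 = n := by simp
    have h4 : (1 : Fin n → ℝ) ⬝ᵥ (β • X) *ᵥ 1 = ∑ i, ∑ j, (β • X) i j := by
      simp [dotProduct, mulVec]
    rw [h3, h4, Real.mul_self_sqrt (Nat.cast_nonneg n)] at h2
    have hn0 : (0 : ℝ) ≤ n := Nat.cast_nonneg n
    refine h2.trans ?_
    have h5 : opNorm (β • X) ≤ n * (M₁ / 300) := by linarith
    nlinarith
  -- The sum of all logits is now computed in two ways. `G` sums to zero and `β X` contributes at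
  -- most `n² M₁ / 300`, so the negative off-diagonal mass `n(n-1)M₂` must come essentially from
  -- `α`, whose bound `M₁ / 3` gives about `2M₁ / 3` per entry.
  have hcG := sum_row_eq_zero_of_mul_centering hn1 ((centering_mul_iff h.psd).1 h.centered)
  set Θ := logitMatrix X α β G with hΘ
  have hΘapp : ∀ i j, Θ i j = α i + α j + (β • X) i j + G i j := fun i j => by
    simp [hΘ, logitMatrix]
  have hs1 : ∑ i, ∑ j, Θ i j = 2 * n * ∑ i, α i + ∑ i, ∑ j, (β • X) i j := by
    simp only [hΘapp, Finset.sum_add_distrib, hcG]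
    simp [← Finset.mul_sum]
    ring
  have hs2 : ∑ i, Θ i i = 2 * ∑ i, α i + G.trace := by
    simp only [hΘapp, Finset.sum_add_distrib, trace, diag_apply, Matrix.smul_apply, hX.2]
    simp
    ring
  have hs3 : ∑ i, ∑ j, Θ i j ≤ ∑ i, Θ i i - n * (n - 1) * M₂ := by
    have h2 : ∀ i j, Θ i j ≤ -M₂ + if i = j then Θ i i + M₂ else 0 := fun i j => by
      split_ifs with hij
      · rw [← hij]; linarith
      · linarith [(h.box.1 i j hij).2]
    calc ∑ i, ∑ j, Θ i j ≤ ∑ i : Fin n, ∑ j : Fin n, (-M₂ + if i = j then Θ i i + M₂ else 0) :=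
          Finset.sum_le_sum fun i _ => Finset.sum_le_sum fun j _ => h2 i j
      _ = _ := by
          simp [Finset.sum_add_distrib]
          ring
  have hα' : -(n * (M₁ / 3)) ≤ ∑ i, α i := by
    have := Finset.sum_le_sum fun i (_ : i ∈ Finset.univ) => (abs_le.1 (hα i)).1
    simpa using this
  have htr : G.trace ≤ n * (M₁ / 3) := by
    have := Finset.sum_le_sum fun i (_ : i ∈ Finset.univ) => hGd i
    simpa [trace] using this
  have hfin : n * ((n - 1) * M₂) ≤ n * ((n - 1) * (3 / 4 * M₁) : ℝ) := by
    rw [hs1, hs2] at hs3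
    have h3 := (abs_le.1 hsumX).1
    have h4 : -((n - 1) * (n * (M₁ / 3))) ≤ (n - 1 : ℝ) * ∑ i, α i := by
      have := mul_le_mul_of_nonneg_left hα' (by linarith : (0 : ℝ) ≤ n - 1)
      linarith
    have h5 : (n : ℝ) * (n * (M₁ / 300)) + n * (M₁ / 3) ≤ n * ((n - 1) * (M₁ / 12)) := by
      rw [← mul_add]
      refine mul_le_mul_of_nonneg_left ?_ (by linarith)
      nlinarith
    nlinarith
  have h6 := le_of_mul_le_mul_left hfin (by linarith)
  exact le_of_mul_le_mul_left h6 (by linarith)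

/-- Below the logarithmic density threshold, `n M₁` is negligible against `e^{M₁}`. -/
theorem mul_le_exp_of_sparse {M₁ M₂ : ℝ} (hn : 1 ≤ n) (h0 : 0 ≤ M₁) (h : M₂ ≤ 3 / 4 * M₁)
    (hs : n * Real.exp (-M₂) < Real.log n) : n * M₁ ≤ 360 * Real.exp M₁ := by
  have hn0 : (0 : ℝ) < n := by exact_mod_cast hn
  have h1 : (n : ℝ) ≤ 36 * Real.exp (9 / 10 * M₁) := by
    -- From `log n ≤ 6 n^{1/6}` one gets `n^{5/6} ≤ 6 e^{M₂}`, and raising to the power `6/5` gives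
    -- the exponent `(6/5)(3/4) = 9/10`. The remaining `e^{M₁/10}` absorbs the factor `M₁`.
    have h2 := Real.log_le_rpow_div hn0.le (by norm_num : (0 : ℝ) < 1 / 6)
    have h3 : (n : ℝ) ^ (5 / 6 : ℝ) ≤ 6 * Real.exp M₂ := by
      have h4 : (n : ℝ) = n ^ (1 / 6 : ℝ) * n ^ (5 / 6 : ℝ) := by
        rw [← Real.rpow_add hn0]; norm_num
      have h5 : (n : ℝ) < 6 * n ^ (1 / 6 : ℝ) * Real.exp M₂ := by
        rw [Real.exp_neg, ← div_eq_mul_inv, div_lt_iff₀ (Real.exp_pos _)] at hs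
        refine hs.trans_le ?_
        gcongr
        linarith
      have h6 : (n : ℝ) ^ (1 / 6 : ℝ) * n ^ (5 / 6 : ℝ) ≤
          n ^ (1 / 6 : ℝ) * (6 * Real.exp M₂) := by
        rw [← h4]; linarith
      exact le_of_mul_le_mul_left h6 (by positivity)
    have h7 := Real.rpow_le_rpow (by positivity) h3 (by norm_num : (0 : ℝ) ≤ 6 / 5)
    rw [← Real.rpow_mul hn0.le, Real.mul_rpow (by norm_num) (Real.exp_pos _).le, ← Real.exp_mul]
      at h7
    norm_num at h7
    refine h7.trans ?_
    have h8 : (6 : ℝ) ^ (6 / 5 : ℝ) ≤ 36 := by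
      calc (6 : ℝ) ^ (6 / 5 : ℝ) ≤ 6 ^ (2 : ℝ) :=
            Real.rpow_le_rpow_of_exponent_le (by norm_num) (by norm_num)
        _ = 36 := by norm_num
    have h9 : M₂ * (6 / 5) ≤ 9 / 10 * M₁ := by linarith
    exact mul_le_mul h8 (Real.exp_le_exp.2 h9) (Real.exp_pos _).le (by norm_num)
  have h2 : M₁ ≤ 10 * Real.exp (1 / 10 * M₁) := by
    have := Real.add_one_le_exp (1 / 10 * M₁)
    linarith
  calc n * M₁ ≤ 36 * Real.exp (9 / 10 * M₁) * (10 * Real.exp (1 / 10 * M₁)) := by gcongr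
    _ = 360 * (Real.exp (9 / 10 * M₁) * Real.exp (1 / 10 * M₁)) := by ring
    _ = 360 * Real.exp M₁ := by rw [← Real.exp_add]; congr 2; ring

/-! ### The tuning parameter dominates the noise -/

/-- The smallest admissible constant in the tuning parameter. -/
noncomputable def tuningConst : ℝ := 2 * √(2 * Real.exp 4 * momentConst) + 4

theorem half_le_sqrt_density (hn : 2 ≤ n) (x : ℝ) : 1 / 2 ≤ √(max x (Real.log n)) := by
  refine Real.le_sqrt_of_sq_le ?_
  have h1 : Real.log 2 ≤ Real.log n := Real.log_le_log (by norm_num) (by exact_mod_cast hn)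
  have h2 := Real.log_two_gt_d9
  have h3 : Real.log n ≤ max x (Real.log n) := le_max_right _ _
  linarith

theorem measure_noise_le_standardLambda {k : ℕ} {M₁ M₂ C₀ : ℝ} {X : Matrix (Fin n) (Fin n) ℝ}
    {α : Fin n → ℝ} {β : ℝ} {G : Matrix (Fin n) (Fin n) ℝ} {Ω : Type*} [MeasurableSpace Ω]
    {μ : Measure Ω} [IsProbabilityMeasure μ] {A : Ω → Matrix (Fin n) (Fin n) ℝ} (hn : 2 ≤ n)
    (hk : 1 ≤ k) (h0 : 0 ≤ M₂) (hX : IsCovariate X) (hclass : InGeneralClass M₁ M₂ X α β G)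
    (hA : IsRandomNetwork μ (probMatrix (logitMatrix X α β G)) A) (hC : tuningConst ≤ C₀) :
    1 - (n : ℝ) ^ (-1 : ℝ) ≤ μ.real {ω |
      2 * opNorm (A ω - probMatrix (logitMatrix X α β G)) ≤ standardLambda C₀ n M₂ ∧
      |traceInner (A ω - probMatrix (logitMatrix X α β G)) ((frobNorm X)⁻¹ • X)| / √(k : ℝ)
        ≤ standardLambda C₀ n M₂} := by
  set P := probMatrix (logitMatrix X α β G) with hPdef
  have hP : Pᵀ = P := by
    have h := logitMatrix_transpose hX.1 (PosSemidef.transpose_eq_self hclass.psd) α β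
    ext i j
    have h' : logitMatrix X α β G j i = logitMatrix X α β G i j := congrFun (congrFun h i) j
    simp [hPdef, probMatrix, h']
  have hP0 : ∀ i j, 0 ≤ P i j := fun i j => Real.sigmoid_nonneg _
  have hP1 : ∀ i j, P i j ≤ 1 := fun i j => Real.sigmoid_le_one _
  have hPp : ∀ i j, i < j → P i j ≤ Real.exp (-M₂) := fun i j hij =>
    (sigmoid_le_exp _).trans (Real.exp_le_exp.2 (hclass.box.1 i j hij.ne).2)
  have b1 := hA.measure_opNorm_ge_le hP hP0 (Real.exp_pos _).le
    (Real.exp_le_one_iff.2 (by linarith)) hPp hP1 hn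
  set d := max (n * Real.exp (-M₂)) (Real.log n) with hd
  set E₁ := {ω | √(2 * Real.exp 4 * momentConst * d) + 1 < opNorm (A ω - P)}
  set E₂ := {ω | 2 * √(Real.log n) < |traceInner (A ω - P) ((frobNorm X)⁻¹ • X)|} with hE₂
  have b2 : μ.real E₂ ≤ 2 / (n : ℝ) ^ 4 := by
    by_cases hX0 : X = 0
    · have : E₂ = ∅ := by
        refine Set.eq_empty_of_forall_notMem fun ω hω => ?_
        have hω' : 2 * √(Real.log n) < |traceInner (A ω - P) ((frobNorm X)⁻¹ • X)| := hω
        rw [hX0, smul_zero, traceInner, Matrix.mul_zero, trace_zero, abs_zero] at hω'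
        linarith [Real.sqrt_nonneg (Real.log n)]
      rw [this, measureReal_empty]
      positivity
    · exact hA.measure_traceInner_ge_le hP hX hX0 (by omega)
  set S := {ω | 2 * opNorm (A ω - P) ≤ standardLambda C₀ n M₂ ∧
      |traceInner (A ω - P) ((frobNorm X)⁻¹ • X)| / √(k : ℝ) ≤ standardLambda C₀ n M₂}
  have hcover : Set.univ ⊆ S ∪ (E₁ ∪ E₂) := by
    intro ω _
    by_cases h1 : ω ∈ E₁
    · exact Or.inr (Or.inl h1)
    by_cases h2 : ω ∈ E₂
    · exact Or.inr (Or.inr h2)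
    have h1' : opNorm (A ω - P) ≤ √(2 * Real.exp 4 * momentConst * d) + 1 := not_lt.1 h1
    have h2' : |traceInner (A ω - P) ((frobNorm X)⁻¹ • X)| ≤ 2 * √(Real.log n) := not_lt.1 h2
    -- The summand 4 in `tuningConst` is used twice: it covers `2 ≤ 4√d` from the diagonal, and the
    -- bound `2√(log n)` for the covariate direction.
    have hhalf : 1 / 2 ≤ √d := half_le_sqrt_density hn _
    have hmc : 0 ≤ 2 * Real.exp 4 * momentConst := by unfold momentConst; positivity
    have hlam : tuningConst * √d ≤ standardLambda C₀ n M₂ := by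
      rw [standardLambda, ← hd]; gcongr
    rw [tuningConst] at hlam
    have hs := Real.sqrt_nonneg (2 * Real.exp 4 * momentConst)
    left
    constructor
    · rw [Real.sqrt_mul hmc] at h1'
      nlinarith
    · have h3 : √(Real.log n) ≤ √d := Real.sqrt_le_sqrt (le_max_right _ _)
      have h4 : |traceInner (A ω - P) ((frobNorm X)⁻¹ • X)| / √(k : ℝ) ≤
          |traceInner (A ω - P) ((frobNorm X)⁻¹ • X)| :=
        div_le_self (abs_nonneg _) (Real.one_le_sqrt.2 (by exact_mod_cast hk))
      nlinarith
  -- Covering and subadditivity replace complementation, so measurability of `S` plays no role.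
  have h1 : (1 : ℝ) ≤ μ.real S + (2 / (n : ℝ) ^ 3 + 2 / (n : ℝ) ^ 4) := by
    calc (1 : ℝ) = μ.real Set.univ := by simp
      _ ≤ μ.real (S ∪ (E₁ ∪ E₂)) := measureReal_mono hcover
      _ ≤ μ.real S + (μ.real E₁ + μ.real E₂) :=
          (measureReal_union_le _ _).trans (add_le_add le_rfl (measureReal_union_le _ _))
      _ ≤ _ := by gcongr
  have hn2 : (2 : ℝ) ≤ n := by exact_mod_cast hn
  have h2 : 2 / (n : ℝ) ^ 3 + 2 / (n : ℝ) ^ 4 ≤ (n : ℝ) ^ (-1 : ℝ) := by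
    rw [Real.rpow_neg_one, inv_eq_one_div, div_add_div _ _ (by positivity) (by positivity),
      div_le_div_iff₀ (by positivity) (by positivity)]
    have h3 : (2 : ℝ) ^ 2 ≤ (n : ℝ) ^ 2 := pow_le_pow_left₀ (by norm_num) hn2 2
    have h4 : (0 : ℝ) ≤ (n : ℝ) ^ 4 := by positivity
    have h5 : (n : ℝ) ^ 4 ≤ (n : ℝ) ^ 5 := pow_le_pow_right₀ (by linarith) (by norm_num)
    have h6 : 4 * (n : ℝ) ^ 5 ≤ (n : ℝ) ^ 7 := by
      have : (n : ℝ) ^ 7 = n ^ 2 * n ^ 5 := by ring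
      rw [this]
      gcongr
      linarith
    have h7 : (2 * (n : ℝ) ^ 4 + n ^ 3 * 2) * n = 2 * n ^ 5 + 2 * n ^ 4 := by ring
    rw [h7]
    linarith [show (1 : ℝ) * (n ^ 3 * n ^ 4) = n ^ 7 by ring]
  linarith

/-! ### Comparison of the deterministic bound with the stated rates -/

theorem exp_mul_standardLambda_sq (hn : 1 ≤ n) (k : ℕ) (M₁ M₂ C₀ : ℝ) :
    Real.exp (2 * M₁) * standardLambda C₀ n M₂ ^ 2 * k = C₀ ^ 2 * psiSq n k M₁ M₂ := by
  have hn0 : (0 : ℝ) < n := by exact_mod_cast hn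
  have h1 : max (n * Real.exp (-M₂)) (Real.log n) =
      n * max (Real.exp (-M₂)) (Real.log n / n) := by
    rw [mul_max_of_nonneg _ _ hn0.le, mul_div_cancel₀ _ hn0.ne']
  have h2 : 0 ≤ max (n * Real.exp (-M₂)) (Real.log n) := le_max_of_le_left (by positivity)
  rw [standardLambda, psiSq, mul_pow, Real.sq_sqrt h2, h1]
  ring

theorem psiSq_nonneg (n k : ℕ) (M₁ M₂ : ℝ) : 0 ≤ psiSq n k M₁ M₂ := by
  have : 0 ≤ max (Real.exp (-M₂)) (Real.log n / n) := le_max_of_le_left (Real.exp_pos _).le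
  rw [psiSq]
  positivity

/-- With a covariate, the penalty term is dominated by the rate also below the logarithmic
density threshold. -/
theorem exp_mul_sqrt_mul_nuclearNorm_le {k : ℕ} {M₁ M₂ : ℝ} {X G B : Matrix (Fin n) (Fin n) ℝ}
    {α : Fin n → ℝ} {β : ℝ} (hn : 2 ≤ n) (hk : 1 ≤ k) (h0 : 0 ≤ M₂) (h1 : M₂ ≤ M₁)
    (hX : IsCovariate X) (hX0 : X ≠ 0) (hst : 10000 * (k : ℝ) ≤ stableRank X)
    (hclass : InGeneralClass M₁ M₂ X α β G) (hB : IsBestRankApprox k G B) :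
    Real.exp M₁ * √(max (n * Real.exp (-M₂)) (Real.log n)) * nuclearNorm (G - B) ≤
      240 * psiSq n k M₁ M₂ + Real.exp (M₁ - M₂ / 2) * √(n : ℝ) * nuclearNorm (G - B) := by
  have hR := nuclearNorm_nonneg (G - B)
  have hψ := psiSq_nonneg n k M₁ M₂
  have hn0 : (0 : ℝ) < n := by positivity
  rcases le_or_gt (Real.log n) (n * Real.exp (-M₂)) with hdense | hsparse
  · have h2 : √(n * Real.exp (-M₂)) = √(n : ℝ) * Real.exp (-M₂ / 2) := by
      rw [Real.sqrt_mul hn0.le, Real.exp_half]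
    have h3 : Real.exp (M₁ - M₂ / 2) = Real.exp M₁ * Real.exp (-M₂ / 2) := by
      rw [← Real.exp_add]; congr 1; ring
    rw [max_eq_left hdense, h2, h3]
    linarith
  · rw [max_eq_right hsparse.le]
    have hM : 0 ≤ M₁ := h0.trans h1
    have hkey := mul_le_exp_of_sparse (by omega) hM
      (hclass.le_of_stableRank hk h0 h1 hX hX0 hst) hsparse
    have htr : G.trace ≤ n * (M₁ / 3) := by
      have := Finset.sum_le_sum fun i (_ : i ∈ Finset.univ) =>
        (hclass.bounded_of_ne_zero hX0).1 i
      simpa [trace] using this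
    -- The residual is bounded by the full trace, `n M₁ / 3 ≤ 120 e^{M₁}`. With `√(log n) ≤ 2 log n`
    -- this gives the constant 240.
    have hRle : nuclearNorm (G - B) ≤ 120 * Real.exp M₁ := by
      linarith [nuclearNorm_residual_le_trace hclass.psd hB]
    have hhalf : 1 / 2 ≤ √(Real.log n) := by
      simpa [max_eq_right hsparse.le] using half_le_sqrt_density hn (n * Real.exp (-M₂))
    have hsq : √(Real.log n) ^ 2 = Real.log n := Real.sq_sqrt (Real.log_natCast_nonneg n)
    have hψge : Real.exp M₁ ^ 2 * Real.log n ≤ psiSq n k M₁ M₂ := by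
      have hk' : (1 : ℝ) ≤ k := by exact_mod_cast hk
      have hlog := Real.log_natCast_nonneg n
      calc Real.exp M₁ ^ 2 * Real.log n = Real.exp (2 * M₁) * n * 1 * (Real.log n / n) := by
            rw [← Real.exp_nat_mul]; push_cast; field_simp
        _ ≤ Real.exp (2 * M₁) * n * k * max (Real.exp (-M₂)) (Real.log n / n) := by
            gcongr
            exact le_max_right _ _
    have hE := Real.exp_pos M₁
    have h4 : Real.exp M₁ * √(Real.log n) * nuclearNorm (G - B) ≤
        Real.exp M₁ * (2 * Real.log n) * (120 * Real.exp M₁) := by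
      gcongr
      nlinarith
    have h5 : 0 ≤ Real.exp (M₁ - M₂ / 2) * √(n : ℝ) * nuclearNorm (G - B) := by positivity
    nlinarith

theorem one_le_tuningConst : 1 ≤ tuningConst := by
  unfold tuningConst
  linarith [Real.sqrt_nonneg (2 * Real.exp 4 * momentConst)]

end LatentSpace

/-! ### Assembly of the deterministic and high-probability bounds -/

theorem theorem4p3 :
    ∃ M₀ : ℝ, 0 < M₀ ∧
    -- deterministic bound
    (∃ C : ℝ, 0 < C ∧
      ∀ (n k : ℕ) (M₁ M₂ : ℝ) (X A : Matrix (Fin n) (Fin n) ℝ)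
        (α : Fin n → ℝ) (β : ℝ) (G B : Matrix (Fin n) (Fin n) ℝ) (lam : ℝ)
        (αhat : Fin n → ℝ) (βhat : ℝ) (Ghat : Matrix (Fin n) (Fin n) ℝ),
        1 ≤ n → 1 ≤ k → 0 ≤ M₂ → M₂ ≤ M₁ →
        LatentSpace.IsCovariate X →
        (X ≠ 0 → M₀ * k ≤ LatentSpace.stableRank X) →
        A.IsAdjMatrix →
        LatentSpace.InGeneralClass M₁ M₂ X α β G →
        LatentSpace.IsBestRankApprox k G B →
        max (max
            (2 * LatentSpace.opNorm
              (A - LatentSpace.probMatrix (LatentSpace.logitMatrix X α β G)))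
            (|LatentSpace.traceInner
                (A - LatentSpace.probMatrix (LatentSpace.logitMatrix X α β G))
                ((LatentSpace.frobNorm X)⁻¹ • X)| / √(k : ℝ))) 1 ≤ lam →
        LatentSpace.IsConvexEstimator A X M₁ M₂ lam αhat βhat Ghat →
        LatentSpace.frobNorm (LatentSpace.logitMatrix X αhat βhat Ghat
            - LatentSpace.logitMatrix X α β G) ^ 2
          ≤ C * (Real.exp (2 * M₁) * lam ^ 2 * k
              + Real.exp M₁ * lam * LatentSpace.nuclearNorm (G - B))) ∧
    -- high-probability bound, uniform over the parameter class
    (∃ Cmin : ℝ, 0 < Cmin ∧ ∀ C₀ : ℝ, Cmin ≤ C₀ →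
      ∃ c C : ℝ, 0 < c ∧ 0 < C ∧
      ∀ (n k : ℕ) (M₁ M₂ : ℝ) (X : Matrix (Fin n) (Fin n) ℝ)
        (α : Fin n → ℝ) (β : ℝ) (G B : Matrix (Fin n) (Fin n) ℝ)
        (Ω : Type*) [MeasurableSpace Ω] (μ : MeasureTheory.Measure Ω)
        [MeasureTheory.IsProbabilityMeasure μ] (A : Ω → Matrix (Fin n) (Fin n) ℝ),
        1 ≤ n → 1 ≤ k → 0 ≤ M₂ → M₂ ≤ M₁ →
        LatentSpace.IsCovariate X →
        (X ≠ 0 → M₀ * k ≤ LatentSpace.stableRank X) →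
        LatentSpace.InGeneralClass M₁ M₂ X α β G →
        LatentSpace.IsBestRankApprox k G B →
        LatentSpace.IsRandomNetwork μ
          (LatentSpace.probMatrix (LatentSpace.logitMatrix X α β G)) A →
        (X ≠ 0 →
          1 - (n : ℝ) ^ (-c) ≤ μ.real {ω |
            ∀ (αhat : Fin n → ℝ) (βhat : ℝ) (Ghat : Matrix (Fin n) (Fin n) ℝ),
              LatentSpace.IsConvexEstimator (A ω) X M₁ M₂
                (LatentSpace.standardLambda C₀ n M₂) αhat βhat Ghat →
              LatentSpace.frobNorm (LatentSpace.logitMatrix X αhat βhat Ghat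
                  - LatentSpace.logitMatrix X α β G) ^ 2
                ≤ C * (LatentSpace.psiSq n k M₁ M₂
                    + Real.exp (M₁ - M₂ / 2) * √(n : ℝ)
                      * LatentSpace.nuclearNorm (G - B))}) ∧
        (X = 0 →
          1 - (n : ℝ) ^ (-c) ≤ μ.real {ω |
            ∀ (αhat : Fin n → ℝ) (βhat : ℝ) (Ghat : Matrix (Fin n) (Fin n) ℝ),
              LatentSpace.IsConvexEstimator (A ω) X M₁ M₂
                (LatentSpace.standardLambda C₀ n M₂) αhat βhat Ghat →
              LatentSpace.frobNorm (LatentSpace.logitMatrix X αhat βhat Ghat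
                  - LatentSpace.logitMatrix X α β G) ^ 2
                ≤ C * (LatentSpace.psiSq n k M₁ M₂
                    + Real.exp M₁ * √(max (n * Real.exp (-M₂)) (Real.log n))
                      * LatentSpace.nuclearNorm (G - B))})) := by
  refine ⟨10000, by norm_num, ⟨1024, by norm_num, ?_⟩,
    ⟨LatentSpace.tuningConst, one_pos.trans_le LatentSpace.one_le_tuningConst, ?_⟩⟩
  · intro n k M₁ M₂ X A α β G B lam αhat βhat Ghat hn hk h0 h1 _ hst _ hclass hB hlam hest
    obtain ⟨hlam', hlam1⟩ := max_le_iff.1 hlam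
    obtain ⟨hop, hXE⟩ := max_le_iff.1 hlam'
    exact LatentSpace.deterministic_bound hn hk h0 h1 hst hclass hB (one_pos.trans_le hlam1) hop
      hXE hest
  · intro C₀ hC₀
    have hC1 : 1 ≤ C₀ := LatentSpace.one_le_tuningConst.trans hC₀
    -- Here `246784 = 1024 · (1 + 240)`: the deterministic constant times the direct `ψ_n²` term
    -- plus the one absorbed from the penalty. `C₀ ≤ C₀²` merges the two powers of `C₀`.
    refine ⟨1, 246784 * C₀ ^ 2, one_pos, by positivity, ?_⟩
    intro n k M₁ M₂ X α β G B Ω _ μ _ A hn hk h0 h1 hX hst hclass hB hA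
    have hC2 : C₀ ≤ C₀ ^ 2 := by nlinarith
    -- For `n = 1` the required probability is `1 - 1 = 0`; otherwise `log n` is bounded below.
    rcases hn.eq_or_lt with rfl | hn2
    · constructor <;> intro _ <;> simp
    have hn2 : 2 ≤ n := hn2
    have hmeas := LatentSpace.measure_noise_le_standardLambda hn2 hk h0 hX hclass hA hC₀
    have hlampos : 0 < LatentSpace.standardLambda C₀ n M₂ := by
      have := LatentSpace.half_le_sqrt_density hn2 (n * Real.exp (-M₂))
      unfold LatentSpace.standardLambda
      positivity
    have hψ := LatentSpace.psiSq_nonneg n k M₁ M₂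
    have hR := LatentSpace.nuclearNorm_nonneg (G - B)
    have hlam : Real.exp M₁ * LatentSpace.standardLambda C₀ n M₂ * LatentSpace.nuclearNorm (G - B) =
        C₀ * (Real.exp M₁ * √(max (n * Real.exp (-M₂)) (Real.log n)) *
          LatentSpace.nuclearNorm (G - B)) := by
      unfold LatentSpace.standardLambda
      ring
    constructor
    · intro hX0
      refine hmeas.trans (measureReal_mono fun ω hω αhat βhat Ghat hest => ?_)
      have hdet := LatentSpace.deterministic_bound hn hk h0 h1 hst hclass hB hlampos hω.1 hω.2 hest
      rw [LatentSpace.exp_mul_standardLambda_sq hn, hlam] at hdet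
      have hcmp := LatentSpace.exp_mul_sqrt_mul_nuclearNorm_le hn2 hk h0 h1 hX hX0 (hst hX0) hclass hB
      set Z := Real.exp (M₁ - M₂ / 2) * √(n : ℝ) * LatentSpace.nuclearNorm (G - B)
      have hZ : 0 ≤ Z := by positivity
      have h2 := mul_le_mul hC2 hcmp (by positivity) (by positivity)
      refine hdet.trans ?_
      nlinarith [mul_nonneg (sq_nonneg C₀) hZ]
    · intro _
      refine hmeas.trans (measureReal_mono fun ω hω αhat βhat Ghat hest => ?_)
      have hdet := LatentSpace.deterministic_bound hn hk h0 h1 hst hclass hB hlampos hω.1 hω.2 hest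
      rw [LatentSpace.exp_mul_standardLambda_sq hn, hlam] at hdet
      set Z := Real.exp M₁ * √(max (n * Real.exp (-M₂)) (Real.log n)) *
        LatentSpace.nuclearNorm (G - B)
      have hZ : 0 ≤ Z := by positivity
      have h2 := mul_le_mul_of_nonneg_right hC2 hZ
      refine hdet.trans ?_
      nlinarith [mul_nonneg (sq_nonneg C₀) hZ, mul_nonneg (sq_nonneg C₀) hψ]
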